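/- **Proposition (Existence of the mean-field process).** Let $T>0$, let $A\in\mathbb R^{d\times d}$, $H\in\mathbb R^{m\times d}$, $\sigma_B\in\mathbb R^{d\times d_B}$ be arbitrary matrices, $\Sigma_B:=\sigma_B\sigma_B^\top$, and let $\Sigma_0\in\mathbb R^{d\times d}$ be symmetric positive definite. On a probability space let $\bar B$ be a standard $d_B$-dimensional Wiener process and $\bar\xi_0\sim\mathcal N(0,\Sigma_0)$ a random vector independent of $\bar B$. Write $|\cdot|$ for the Euclidean norm and $\|\cdot\|$ for the spectral norm. For $t\in[0,T]$ put $$L_{2,t}(X,Y)=\Big(\mathsf E\sup_{s\in[0,t]}|X_s-Y_s|^2\Big)^{1/2},\qquad l_{2,t}(Q,U)=\sup_{s\in[0,t]}\|Q_s-U_s\|.$$ Let $\mathcal X$ be the set of random processes $X$ with paths in $C([0,T],\mathbb R^d)$ and $L_{2,T}(X,0)<\infty$, and let $\mathcal S$ be the set of continuous functions from $[0,T]$ to the symmetric positive definite $d\times d$ matrices. For $Q\in\mathcal S$ consider the linear SDE $$d\bar\xi^{(Q)}_t=\big(A-\tfrac12 Q_tH^\top H\big)\bar\xi^{(Q)}_t\,dt+\sigma_B\,d\bar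 B_t,\qquad \bar\xi^{(Q)}_0=\bar\xi_0, \tag{1}$$ and the McKean–Vlasov SDE $$d\bar\xi_t=\big(A-\tfrac12\bar\Sigma_tH^\top H\big)\bar\xi_t\,dt+\sigma_B\,d\bar B_t,\qquad \bar\Sigma_t=\mathsf E[\bar\xi_t\bar\xi_t^\top], \tag{2}$$ started from $\bar\xi_0$. A solution is *strong* if it is adapted to the completed filtration generated by $\bar\xi_0$ and $\bar B$; solutions are unique if any two of them are indistinguishable. For $Q\in\mathcal S$ and $t\in[0,T]$ let $\kappa=\kappa_t(Q)=\|A\|+\tfrac12\,l_{2,t}(Q,0)\,\|H^\top H\|$. (i) For every $Q\in\mathcal S$, equation (1) has a strong solution in $\mathcal X$, and it is the unique solution in $\mathcal X$. The map $F:\mathcal S\to\mathcal S$, $F(Q)_t=\mathsf E[\bar\xi^{(Q)}_t(\bar\xi^{(Q)}_t)^\top]$, is well defined, and for all $Q\in\mathcal S$, $t\in[0,T]$, $$l_{2,t}(F(Q),0)\le e^{2\kappa t}\|\Sigma_0\|+\frac{e^{2\kappa t}-1}{2\kappa}\|\Sigma_B\|,$$ where the quotient is read as $t$ if $\kappa=0$.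 (ii) For all $Q,U\in\mathcal S$ and $t\in[0,T]$, with $\kappa=\kappa_t(Q)$, $$l_{2,t}(F(Q),F(U))\le C_2\int_0^t l_{2,s}(Q,U)\,ds,\qquad L_{2,t}(\bar\xi^{(Q)},\bar\xi^{(U)})\le C_1\int_0^t l_{2,s}(Q,U)\,ds,$$ where $$C_2=e^{2\kappa t}\,\|H^\top H\|\;l_{2,t}(F(U),0),\qquad C_1=\tfrac12\,\|H^\top H\|\,e^{\kappa t}\sqrt{d\;l_{2,t}(F(U),0)} .$$ (iii) The McKean–Vlasov equation (2) has a strong solution in $\mathcal X$, and it is the unique solution in $\mathcal X$. -/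

import Mathlib

open MeasureTheory ProbabilityTheory
open scoped Matrix NNReal ENNReal Matrix.Norms.L2Operator

/- Matrices carry the spectral norm (the operator norm for the Euclidean norms). -/

noncomputable section

namespace FPF

/-- `ℝⁿ` with the Euclidean norm. -/
abbrev Vec (n : ℕ) : Type := EuclideanSpace ℝ (Fin n)

/-- The linear map `x ↦ M x` between Euclidean spaces. -/
abbrev act {k n : ℕ} (M : Matrix (Fin k) (Fin n) ℝ) (x : Vec n) : Vec k :=
  Matrix.toEuclideanLin M x

/-- A standard Wiener process in `ℝⁿ`: the coordinates are independent real Brownian motions. -/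
structure IsWiener {Ω : Type*} [MeasurableSpace Ω] {n : ℕ} (B : ℝ≥0 → Ω → Vec n)
    (P : Measure Ω) : Prop where
  measurable : ∀ t, Measurable (B t)
  brownian : ∀ j, IsBrownianReal (fun t ω => B t ω j) P
  indep : iIndepFun (fun (j : Fin n) (ω : Ω) (t : ℝ≥0) => B t ω j) P

/-- `𝒮`: continuous paths on `[0, T]` of symmetric positive definite matrices. -/
abbrev CovPath (d : ℕ) (T : ℝ) : Type :=
  {Q : C(Set.Icc (0 : ℝ) T, Matrix (Fin d) (Fin d) ℝ) // ∀ t, (Q t).PosDef}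

/-- `l_{2,t}(Q, U) = sup_{s ∈ [0, t]} ‖Q_s - U_s‖₂`, for `t ∈ [0, T]`. -/
def l2 {d : ℕ} {T : ℝ} (t : ℝ) (Q U : C(Set.Icc (0 : ℝ) T, Matrix (Fin d) (Fin d) ℝ)) : ℝ :=
  ⨆ s : {s : Set.Icc (0 : ℝ) T // (s : ℝ) ≤ t}, ‖Q s.1 - U s.1‖

/-- A family of random variables indexed by `[0, T]`, all of whose paths are continuous. -/
abbrev RandPath (Ω : Type*) (d : ℕ) (T : ℝ) : Type _ := Ω → C(Set.Icc (0 : ℝ) T, Vec d)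

/-- `L_{2,t}(X, Y) = (E[sup_{s ∈ [0, t]} |X_s - Y_s|²])^{1/2}`, with values in `[0, ∞]`. -/
def L2 {Ω : Type*} [MeasurableSpace Ω] (P : Measure Ω) {d : ℕ} {T : ℝ} (t : ℝ)
    (X Y : RandPath Ω d T) : ℝ≥0∞ :=
  (∫⁻ ω, ⨆ s : {s : Set.Icc (0 : ℝ) T // (s : ℝ) ≤ t},
    ‖X ω s.1 - Y ω s.1‖ₑ ^ 2 ∂P) ^ (1 / 2 : ℝ)

/-- Membership in `𝒳`: a random process with continuous paths and `L_{2,T}(X, 0) < ∞`. -/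
structure InX {Ω : Type*} [MeasurableSpace Ω] (P : Measure Ω) {d : ℕ} {T : ℝ}
    (X : RandPath Ω d T) : Prop where
  aemeasurable : ∀ t, AEMeasurable (fun ω => X ω t) P
  finite : L2 P T X (fun _ => 0) < ∞

/-- `E[X_t X_tᵀ]`. -/
def secondMoment {Ω : Type*} [MeasurableSpace Ω] (P : Measure Ω) {d : ℕ} {T : ℝ}
    (X : RandPath Ω d T) (t : Set.Icc (0 : ℝ) T) : Matrix (Fin d) (Fin d) ℝ :=
  Matrix.of fun i j => ∫ ω, X ω t i * X ω t j ∂P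

/-- `√Ricc(Q) = A - ½ Q HᵀH`. -/
def sqrtRicc {d m : ℕ} (A : Matrix (Fin d) (Fin d) ℝ) (H : Matrix (Fin m) (Fin d) ℝ)
    (Q : Matrix (Fin d) (Fin d) ℝ) : Matrix (Fin d) (Fin d) ℝ :=
  A - (1 / 2 : ℝ) • (Q * (Hᵀ * H))

/-- `ξ` solves `dξ = √Ricc(Q_t) ξ dt + σ_B dB` on `[0, T]` with initial value `ξ₀`. The noise
coefficient is constant, so the stochastic integral `∫₀ᵗ σ_B dB` is `σ_B B_t`. On `[0, T]` the
projection `Set.projIcc` is the identity. -/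
def Solves {Ω : Type*} [MeasurableSpace Ω] (P : Measure Ω) {d m dB : ℕ} {T : ℝ} (hT : 0 ≤ T)
    (A : Matrix (Fin d) (Fin d) ℝ) (H : Matrix (Fin m) (Fin d) ℝ)
    (σB : Matrix (Fin d) (Fin dB) ℝ) (ξ₀ : Ω → Vec d) (B : ℝ≥0 → Ω → Vec dB)
    (Q : Set.Icc (0 : ℝ) T → Matrix (Fin d) (Fin d) ℝ) (ξ : RandPath Ω d T) : Prop :=
  ∀ᵐ ω ∂P, ∀ t : Set.Icc (0 : ℝ) T,
    ξ ω t = ξ₀ ω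
      + (∫ s in (0 : ℝ)..t, act (sqrtRicc A H (Q (Set.projIcc 0 T hT s)))
          (ξ ω (Set.projIcc 0 T hT s)))
      + act σB (B (t : ℝ).toNNReal ω)

/-- `ξ` solves the McKean-Vlasov equation, in which `Q_t` is `E[ξ_t ξ_tᵀ]` for `ξ` itself. -/
def SolvesMcKeanVlasov {Ω : Type*} [MeasurableSpace Ω] (P : Measure Ω) {d m dB : ℕ} {T : ℝ}
    (hT : 0 ≤ T) (A : Matrix (Fin d) (Fin d) ℝ) (H : Matrix (Fin m) (Fin d) ℝ)
    (σB : Matrix (Fin d) (Fin dB) ℝ) (ξ₀ : Ω → Vec d) (B : ℝ≥0 → Ω → Vec dB)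
    (ξ : RandPath Ω d T) : Prop :=
  Solves P hT A H σB ξ₀ B (secondMoment P ξ) ξ

/-- The σ-algebra generated by `ξ₀` and `B_s`, `s ≤ t`. -/
abbrev inputSigma {Ω : Type*} {d dB : ℕ} (ξ₀ : Ω → Vec d) (B : ℝ≥0 → Ω → Vec dB) (t : ℝ≥0) :
    MeasurableSpace Ω :=
  MeasurableSpace.comap ξ₀ inferInstance ⊔
    ⨆ s : Set.Iic t, MeasurableSpace.comap (B s) inferInstance

/-- `ξ` is a strong process: it is adapted to the `P`-completed filtration generated by the
initial value and the noise, i.e. each `ξ_t` agrees almost surely with a random variable that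
is measurable with respect to `inputSigma ξ₀ B t`. -/
def IsStrong {Ω : Type*} [MeasurableSpace Ω] (P : Measure Ω) {d dB : ℕ} {T : ℝ}
    (ξ₀ : Ω → Vec d) (B : ℝ≥0 → Ω → Vec dB) (ξ : RandPath Ω d T) : Prop :=
  ∀ t : Set.Icc (0 : ℝ) T,
    AEStronglyMeasurable[inputSigma ξ₀ B (t : ℝ).toNNReal] (fun ω => ξ ω t) P

/-- The equation with solution predicate `sol` has a strong solution in `𝒳`, and every solution
in `𝒳` (even one that is not adapted) is indistinguishable from it. -/
def HasUniqueStrongSolution {Ω : Type*} [MeasurableSpace Ω] (P : Measure Ω) {d dB : ℕ} {T : ℝ}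
    (ξ₀ : Ω → Vec d) (B : ℝ≥0 → Ω → Vec dB) (sol : RandPath Ω d T → Prop) : Prop :=
  ∃ ξ : RandPath Ω d T, InX P ξ ∧ IsStrong P ξ₀ B ξ ∧ sol ξ ∧
    ∀ η : RandPath Ω d T, InX P η → sol η → ∀ᵐ ω ∂P, η ω = ξ ω

/-- `κ = ‖A‖₂ + l_{2,t}(Q, 0) ‖HᵀH‖₂ / 2`. -/
def kappa {d m : ℕ} {T : ℝ} (A : Matrix (Fin d) (Fin d) ℝ) (H : Matrix (Fin m) (Fin d) ℝ)
    (t : ℝ) (Q : CovPath d T) : ℝ :=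
  ‖A‖ + l2 t Q.1 0 * ‖Hᵀ * H‖ / 2

/-- `(e^{2κt} - 1) / (2κ)`, read as its limit `t` if `κ = 0`. -/
def expQuot (κ t : ℝ) : ℝ :=
  if κ = 0 then t else (Real.exp (2 * κ * t) - 1) / (2 * κ)

end FPF

end

/-! The noise is additive, so for a given `Q` the SDE is, path by path, a linear Volterra equation
`x = g + ∫ a x` with input `g = ξ₀ + σ B`. Powers of the Volterra operator decay factorially, so the
equation is solved by a bounded linear operator `resolvent` on `C([0, T])` (`eq_resolvent_iff`). The
solution is `resolvent` applied to `g`, which gives uniqueness at once. It lies in `𝒳` because the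
law of each Brownian coordinate on `C([0, T])` is Gaussian, hence has a square integrable norm by
Fernique (`memLp_two_of_isGaussianProcess`). It is adapted because its value at `t` depends only on
`g` stopped at `t` (`isStrong_resolvent`).

Itô calculus is avoided in computing the second moment: `y = x - n`, with `n` the noise path, is
differentiable in time, so the ordinary product rule applies to `y yᵀ`. Uncorrelated increments make
the mixed drift terms cancel in expectation, and `E[X Xᵀ]` solves the Lyapunov equation `V' = M V +
V Mᵀ + Σ_B` (`isLyapunov_crossMoment`). Thus `F(Q)` is a deterministic object, and its two bounds
are Grönwall estimates for this equation. The bound on `ξ^(Q) - ξ^(U)` is a pathwise Grönwall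
estimate, followed by a Cauchy–Schwarz inequality with weight `l_{2,r}(Q, U)` and by `E|η_r|² = tr
F(U)_r ≤ d ‖F(U)_r‖`.

A fixed point `F(V) = V` is a solution of the Riccati equation `V' = A V + V Aᵀ - V HᵀH V + Σ_B`. It
is linearized as `V = X Y⁻¹` with a Hamiltonian system for `(X, Y)`; monotonicity of `Yᵀ X` keeps
`Y` invertible and `V` positive definite on all of `[0, T]` (`exists_riccati`). Its zero quadratic
term case yields positive definiteness of `F(Q)`. Existence and uniqueness for the Riccati equation
transfer to the McKean–Vlasov equation, with no fixed-point iteration. -/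

noncomputable section

namespace FPF

open Set Filter Topology

/-! ### Grönwall inequalities -/

/-- Integral form of Grönwall's inequality. -/
lemma le_gronwallBound_of_le_integral {u : ℝ → ℝ} (hu : Continuous u) {a K ε t : ℝ} (hK : 0 ≤ K)
    (h : ∀ s ∈ Icc 0 t, u s ≤ a + ∫ r in (0 : ℝ)..s, (K * u r + ε)) :
    ∀ s ∈ Icc 0 t, u s ≤ gronwallBound a K ε s := by
  have hc : Continuous fun r => K * u r + ε := by fun_prop
  have hd : ∀ x, HasDerivAt (fun s => a + ∫ r in (0 : ℝ)..s, (K * u r + ε)) (K * u x + ε) x :=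
    fun x => (hc.integral_hasStrictDerivAt 0 x).hasDerivAt.const_add a
  intro s hs
  refine (h s hs).trans ?_
  -- Grönwall is applied to the right-hand side, since `u` is only continuous: its derivative `K u +
  -- ε` is at most `K` times itself plus `ε`.
  have := le_gronwallBound_of_liminf_deriv_right_le
    (f := fun s => a + ∫ r in (0 : ℝ)..s, (K * u r + ε)) (f' := fun x => K * u x + ε)
    (δ := a) (K := K) (ε := ε) (a := 0) (b := t)
    (fun x _ => (hd x).continuousAt.continuousWithinAt)
    (fun x _ r hr => (hd x).hasDerivWithinAt.liminf_right_slope_le hr) (by simp)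
    (fun x hx => by gcongr; exact h x (Ico_subset_Icc_self hx)) s hs
  simpa using this

variable {F : Type*} [NormedAddCommGroup F] [NormedSpace ℝ F]

/-- Grönwall's inequality for vector-valued integral equations. -/
lemma norm_le_gronwallBound_of_eq_integral {f g : ℝ → F} (hf : Continuous f) {x₀ : F}
    {a K ε t : ℝ} (hK : 0 ≤ K) (ha : ‖x₀‖ ≤ a)
    (h : ∀ s ∈ Icc 0 t, f s = x₀ + ∫ r in (0 : ℝ)..s, g r)
    (hg : ∀ r ∈ Icc 0 t, ‖g r‖ ≤ K * ‖f r‖ + ε) :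
    ∀ s ∈ Icc 0 t, ‖f s‖ ≤ gronwallBound a K ε s := by
  refine le_gronwallBound_of_le_integral hf.norm hK fun s hs => ?_
  rw [h s hs]
  refine (norm_add_le _ _).trans (add_le_add ha ?_)
  refine intervalIntegral.norm_integral_le_of_norm_le hs.1 (ae_of_all _ fun r hr => ?_)
    (Continuous.intervalIntegrable (by fun_prop) _ _)
  exact hg r ⟨hr.1.le, hr.2.trans hs.2⟩

/-! ### Linear Volterra equations and their resolvent -/

variable {T : ℝ}

lemma continuous_comp_projIcc {X : Type*} [TopologicalSpace X] (hT : 0 ≤ T)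
    (f : C(Icc (0 : ℝ) T, X)) :
    Continuous fun s : ℝ => f (projIcc 0 T hT s) :=
  f.continuous.comp continuous_projIcc

lemma continuous_clm_apply_projIcc {G : Type*} [NormedAddCommGroup G] [NormedSpace ℝ G] (hT : 0 ≤ T)
    (a : C(Icc (0 : ℝ) T, F →L[ℝ] G)) (f : C(Icc (0 : ℝ) T, F)) :
    Continuous fun s : ℝ => a (projIcc 0 T hT s) (f (projIcc 0 T hT s)) :=
  (continuous_comp_projIcc hT a).clm_apply (continuous_comp_projIcc hT f)

/-- The Volterra operator `f ↦ ∫₀ᵗ a(s) f(s) ds` as a linear map. -/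
def volterraLM (hT : 0 ≤ T) (a : C(Icc (0 : ℝ) T, F →L[ℝ] F)) :
    C(Icc (0 : ℝ) T, F) →ₗ[ℝ] C(Icc (0 : ℝ) T, F) where
  toFun f := ⟨fun t => ∫ s in (0 : ℝ)..t, a (projIcc 0 T hT s) (f (projIcc 0 T hT s)),
    (intervalIntegral.continuous_primitive
      (fun _ _ => (continuous_clm_apply_projIcc hT a f).intervalIntegrable _ _) 0).comp
      continuous_subtype_val⟩
  map_add' f g := by
    ext t
    simp only [ContinuousMap.add_apply, map_add, ContinuousMap.coe_mk]
    exact intervalIntegral.integral_add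
      ((continuous_clm_apply_projIcc hT a f).intervalIntegrable _ _)
      ((continuous_clm_apply_projIcc hT a g).intervalIntegrable _ _)
  map_smul' c f := by
    ext t
    simp [intervalIntegral.integral_smul]

/-- Integrating `‖a‖ (‖a‖ s)ⁿ / n!` raises the exponent and the factorial together. Keeping the
bound dependent on `t` is what allows iteration. -/
lemma norm_volterraLM_apply_le (hT : 0 ≤ T) (a : C(Icc (0 : ℝ) T, F →L[ℝ] F))
    {f : C(Icc (0 : ℝ) T, F)} {C : ℝ} {n : ℕ}
    (hf : ∀ t, ‖f t‖ ≤ (‖a‖ * t) ^ n / n.factorial * C) (t : Icc (0 : ℝ) T) :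
    ‖volterraLM hT a f t‖ ≤ (‖a‖ * t) ^ (n + 1) / (n + 1).factorial * C := by
  have h1 : ‖volterraLM hT a f t‖ ≤
      ∫ s in (0 : ℝ)..t, ‖a‖ * ((‖a‖ * s) ^ n / n.factorial * C) := by
    refine intervalIntegral.norm_integral_le_of_norm_le t.2.1 (ae_of_all _ fun r hr => ?_)
      (Continuous.intervalIntegrable (by fun_prop) _ _)
    have hr' : r ∈ Icc 0 T := ⟨hr.1.le, hr.2.trans t.2.2⟩
    rw [projIcc_of_mem hT hr']
    exact (ContinuousLinearMap.le_opNorm _ _).trans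
      (mul_le_mul (a.norm_coe_le_norm _) (hf _) (by positivity) (by positivity))
  refine h1.trans (le_of_eq ?_)
  have : ∀ s : ℝ, ‖a‖ * ((‖a‖ * s) ^ n / n.factorial * C)
      = (‖a‖ ^ (n + 1) / n.factorial * C) * s ^ n := fun s => by
    rw [mul_pow]; ring
  simp_rw [this]
  rw [intervalIntegral.integral_const_mul, integral_pow, Nat.factorial_succ, mul_pow]
  push_cast
  field_simp
  simp

/-- The Volterra operator `f ↦ ∫₀ᵗ a(s) f(s) ds` on continuous paths. -/
def volterra (hT : 0 ≤ T) (a : C(Icc (0 : ℝ) T, F →L[ℝ] F)) :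
    C(Icc (0 : ℝ) T, F) →L[ℝ] C(Icc (0 : ℝ) T, F) :=
  (volterraLM hT a).mkContinuous (‖a‖ * T) fun f => by
    rw [ContinuousMap.norm_le _ (by positivity)]
    intro t
    refine (norm_volterraLM_apply_le hT a (n := 0) (C := ‖f‖)
      (fun t => by simpa using f.norm_coe_le_norm t) t).trans ?_
    simp only [zero_add, pow_one, Nat.factorial_one, Nat.cast_one, div_one]
    gcongr
    exact t.2.2

lemma volterra_apply (hT : 0 ≤ T) (a : C(Icc (0 : ℝ) T, F →L[ℝ] F)) (f : C(Icc (0 : ℝ) T, F))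
    (t : Icc (0 : ℝ) T) :
    volterra hT a f t = ∫ s in (0 : ℝ)..t, a (projIcc 0 T hT s) (f (projIcc 0 T hT s)) := rfl

lemma norm_volterra_pow_apply_le (hT : 0 ≤ T) (a : C(Icc (0 : ℝ) T, F →L[ℝ] F))
    (f : C(Icc (0 : ℝ) T, F)) (n : ℕ) (t : Icc (0 : ℝ) T) :
    ‖(volterra hT a ^ n) f t‖ ≤ (‖a‖ * t) ^ n / n.factorial * ‖f‖ := by
  induction n generalizing t with
  | zero => simpa using f.norm_coe_le_norm t
  | succ n ih =>
    rw [pow_succ']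
    exact norm_volterraLM_apply_le hT a ih t

/-- The operator need not be a contraction, but some power `Kⁿ` is, because `(‖a‖ T)ⁿ / n! → 0`.
Then `1 - Kⁿ` is invertible, and `1 - K` is one of its commuting factors. -/
lemma isUnit_one_sub_volterra [CompleteSpace F] (hT : 0 ≤ T) (a : C(Icc (0 : ℝ) T, F →L[ℝ] F)) :
    IsUnit (1 - volterra hT a) := by
  obtain ⟨n, hn⟩ : ∃ n : ℕ, (‖a‖ * T) ^ n / n.factorial < 1 :=
    ((FloorSemiring.tendsto_pow_div_factorial_atTop (‖a‖ * T)).eventually_lt_const one_pos).exists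
  have h1 : ‖volterra hT a ^ n‖ ≤ (‖a‖ * T) ^ n / n.factorial := by
    refine ContinuousLinearMap.opNorm_le_bound _ (by positivity) fun f => ?_
    rw [ContinuousMap.norm_le _ (by positivity)]
    intro t
    refine (norm_volterra_pow_apply_le hT a f n t).trans ?_
    have := t.2.1
    gcongr
    exact t.2.2
  have h2 : IsUnit (1 - volterra hT a ^ n) :=
    isUnit_one_sub_of_norm_lt_one (x := volterra hT a ^ n) (h1.trans_lt hn)
  rw [← mul_neg_geom_sum] at h2
  exact ((Commute.isUnit_mul_iff (by
    rw [commute_iff_eq, mul_neg_geom_sum, geom_sum_mul_neg])).1 h2).1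

/-- The solution operator `g ↦ f` of the linear Volterra equation `f = g + ∫₀ᵗ a(s) f(s) ds`. -/
def resolvent [CompleteSpace F] (hT : 0 ≤ T) (a : C(Icc (0 : ℝ) T, F →L[ℝ] F)) :
    C(Icc (0 : ℝ) T, F) →L[ℝ] C(Icc (0 : ℝ) T, F) :=
  ↑((isUnit_one_sub_volterra hT a).unit⁻¹)

/-- Existence and uniqueness in one equivalence. As the solution map is bounded and linear,
measurability and moments pass from the input to the solution. -/
lemma eq_resolvent_iff [CompleteSpace F] (hT : 0 ≤ T) (a : C(Icc (0 : ℝ) T, F →L[ℝ] F))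
    (f g : C(Icc (0 : ℝ) T, F)) :
    f = resolvent hT a g ↔
      ∀ t, f t = g t + ∫ s in (0 : ℝ)..t, a (projIcc 0 T hT s) (f (projIcc 0 T hT s)) := by
  set u := (isUnit_one_sub_volterra hT a).unit
  have hu : (u : C(Icc (0 : ℝ) T, F) →L[ℝ] C(Icc (0 : ℝ) T, F)) = 1 - volterra hT a := rfl
  have key : f = resolvent hT a g ↔ (1 - volterra hT a) f = g := by
    rw [← hu]
    constructor
    · rintro rfl
      exact congr($(u.mul_inv) g)
    · rintro rfl
      exact (congr($(u.inv_mul) f)).symm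
  rw [key, ContinuousMap.ext_iff]
  refine forall_congr' fun t => ?_
  rw [← volterra_apply]
  exact sub_eq_iff_eq_add

/-! ### Calculus of matrix-valued functions -/

/-- Transposition as a continuous linear map. -/
def transposeL (k n : ℕ) : Matrix (Fin k) (Fin n) ℝ →L[ℝ] Matrix (Fin n) (Fin k) ℝ :=
  LinearMap.toContinuousLinearMap
    (Matrix.transposeLinearEquiv (Fin k) (Fin n) ℝ ℝ).toLinearMap

lemma norm_transpose {k n : ℕ} (M : Matrix (Fin k) (Fin n) ℝ) : ‖Mᵀ‖ = ‖M‖ := by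
  rw [← Matrix.conjTranspose_eq_transpose_of_trivial, Matrix.l2_opNorm_conjTranspose]

/-- The quadratic form `M ↦ vᵀ M v` as a continuous linear functional of the matrix. -/
def quadL {n : ℕ} (v : Fin n → ℝ) : Matrix (Fin n) (Fin n) ℝ →L[ℝ] ℝ :=
  LinearMap.toContinuousLinearMap
    { toFun := fun M => v ⬝ᵥ M *ᵥ v
      map_add' := fun M N => by simp [Matrix.add_mulVec]
      map_smul' := fun c M => by simp [Matrix.smul_mulVec] }

@[simp] lemma quadL_apply {n : ℕ} (v : Fin n → ℝ) (M : Matrix (Fin n) (Fin n) ℝ) :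
    quadL v M = v ⬝ᵥ M *ᵥ v := rfl

lemma transpose_intervalIntegral {k n : ℕ} {g : ℝ → Matrix (Fin k) (Fin n) ℝ} (hg : Continuous g)
    (a b : ℝ) : (∫ s in a..b, g s)ᵀ = ∫ s in a..b, (g s)ᵀ :=
  ((transposeL k n).intervalIntegral_comp_comm (hg.intervalIntegrable a b)).symm

lemma posSemidef_intervalIntegral {n : ℕ} {g : ℝ → Matrix (Fin n) (Fin n) ℝ} (hg : Continuous g)
    {t : ℝ} (ht : 0 ≤ t) (h : ∀ s ∈ Icc 0 t, (g s).PosSemidef) :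
    (∫ s in (0 : ℝ)..t, g s).PosSemidef := by
  refine Matrix.PosSemidef.of_dotProduct_mulVec_nonneg ?_ fun v => ?_
  · rw [Matrix.IsHermitian, Matrix.conjTranspose_eq_transpose_of_trivial,
      transpose_intervalIntegral hg]
    refine intervalIntegral.integral_congr fun s hs => ?_
    rw [uIcc_of_le ht] at hs
    have := (h s hs).isHermitian
    rwa [Matrix.IsHermitian, Matrix.conjTranspose_eq_transpose_of_trivial] at this
  · rw [star_trivial, ← quadL_apply,
      ← (quadL v).intervalIntegral_comp_comm (hg.intervalIntegrable 0 t)]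
    refine intervalIntegral.integral_nonneg ht fun s hs => ?_
    simpa using (h s hs).dotProduct_mulVec_nonneg v

lemma transpose_posSemidef_eq {n : ℕ} {S : Matrix (Fin n) (Fin n) ℝ} (hS : S.PosSemidef) :
    Sᵀ = S := by
  rw [← Matrix.conjTranspose_eq_transpose_of_trivial]; exact hS.isHermitian

lemma hasDerivAt_transpose {k n : ℕ} {f : ℝ → Matrix (Fin k) (Fin n) ℝ}
    {f' : Matrix (Fin k) (Fin n) ℝ} {t : ℝ} (hf : HasDerivAt f f' t) :
    HasDerivAt (fun s => (f s)ᵀ) f'ᵀ t :=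
  (transposeL k n).hasFDerivAt.comp_hasDerivAt t hf

lemma hasDerivAt_matrix_inv {n : ℕ} {f : ℝ → Matrix (Fin n) (Fin n) ℝ}
    {f' : Matrix (Fin n) (Fin n) ℝ} {t : ℝ} (hf : HasDerivAt f f' t) (ht : IsUnit (f t)) :
    HasDerivAt (fun s => (f s)⁻¹) (-((f t)⁻¹ * f' * (f t)⁻¹)) t := by
  obtain ⟨u, hu⟩ := ht
  have h := hasFDerivAt_ringInverse (𝕜 := ℝ) u
  rw [hu] at h
  have h2 := h.comp_hasDerivAt t hf
  simp only [Matrix.nonsing_inv_eq_ringInverse]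
  have h3 : (↑u⁻¹ : Matrix (Fin n) (Fin n) ℝ) = Ring.inverse (f t) := by
    rw [← hu, Ring.inverse_unit]
  rw [h3] at h2
  exact h2

/-! ### The Hamiltonian system and the Riccati equation -/

/-- Left multiplication as a continuous linear map into operators. -/
abbrev mulL (n : ℕ) : Matrix (Fin n) (Fin n) ℝ →L[ℝ]
    Matrix (Fin n) (Fin n) ℝ →L[ℝ] Matrix (Fin n) (Fin n) ℝ :=
  ContinuousLinearMap.mul ℝ (Matrix (Fin n) (Fin n) ℝ)

/-- The coefficient `(X, Y) ↦ (M X + R Y, S X - Mᵀ Y)` of the Hamiltonian system. -/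
def hamiltonian {n : ℕ} (S R M : Matrix (Fin n) (Fin n) ℝ) :
    (Matrix (Fin n) (Fin n) ℝ × Matrix (Fin n) (Fin n) ℝ) →L[ℝ]
      (Matrix (Fin n) (Fin n) ℝ × Matrix (Fin n) (Fin n) ℝ) :=
  (mulL n M ∘L ContinuousLinearMap.fst ℝ _ _ + mulL n R ∘L ContinuousLinearMap.snd ℝ _ _).prod
    (mulL n S ∘L ContinuousLinearMap.fst ℝ _ _ - mulL n Mᵀ ∘L ContinuousLinearMap.snd ℝ _ _)

lemma continuous_hamiltonian {n : ℕ} (S R : Matrix (Fin n) (Fin n) ℝ) :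
    Continuous (hamiltonian S R) := by
  have h : Continuous fun M : Matrix (Fin n) (Fin n) ℝ => mulL n Mᵀ :=
    (mulL n).continuous.comp (transposeL n n).continuous
  have h1 : Continuous fun M : Matrix (Fin n) (Fin n) ℝ =>
      mulL n M ∘L ContinuousLinearMap.fst ℝ _ (Matrix (Fin n) (Fin n) ℝ)
        + mulL n R ∘L ContinuousLinearMap.snd ℝ _ _ :=
    ((mulL n).continuous.clm_comp continuous_const).add continuous_const
  have h2 : Continuous fun M : Matrix (Fin n) (Fin n) ℝ =>
      mulL n S ∘L ContinuousLinearMap.fst ℝ _ (Matrix (Fin n) (Fin n) ℝ)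
        - mulL n Mᵀ ∘L ContinuousLinearMap.snd ℝ _ _ :=
    continuous_const.sub (h.clm_comp continuous_const)
  exact (ContinuousLinearMap.prodₗᵢ ℝ).continuous.comp (h1.prodMk h2)

/-- Linearity gives a solution on all of `[0, T]`. Extending the integrand to `ℝ` by its endpoint
values makes the derivatives two-sided at `0` and `T` as well. -/
lemma exists_hamiltonian {n : ℕ} {T : ℝ} (hT : 0 ≤ T)
    (A : C(Icc (0 : ℝ) T, Matrix (Fin n) (Fin n) ℝ)) (S R S₀ : Matrix (Fin n) (Fin n) ℝ) :
    ∃ X Y : ℝ → Matrix (Fin n) (Fin n) ℝ, X 0 = S₀ ∧ Y 0 = 1 ∧ Continuous X ∧ Continuous Y ∧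
      ∀ t ∈ Icc 0 T,
        HasDerivAt X (A (projIcc 0 T hT t) * X t + R * Y t) t ∧
        HasDerivAt Y (S * X t - (A (projIcc 0 T hT t))ᵀ * Y t) t := by
  let a : C(Icc (0 : ℝ) T, (Matrix (Fin n) (Fin n) ℝ × Matrix (Fin n) (Fin n) ℝ) →L[ℝ]
      (Matrix (Fin n) (Fin n) ℝ × Matrix (Fin n) (Fin n) ℝ)) :=
    ⟨fun t => hamiltonian S R (A t), (continuous_hamiltonian S R).comp A.continuous⟩
  let z := resolvent hT a (ContinuousMap.const _ (S₀, 1))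
  have hz := (eq_resolvent_iff hT a z (ContinuousMap.const _ (S₀, 1))).1 rfl
  have hc := continuous_clm_apply_projIcc hT a z
  let Z : ℝ → Matrix (Fin n) (Fin n) ℝ × Matrix (Fin n) (Fin n) ℝ := fun t =>
    (S₀, 1) + ∫ s in (0 : ℝ)..t, a (projIcc 0 T hT s) (z (projIcc 0 T hT s))
  have hZ : ∀ t, HasDerivAt Z (a (projIcc 0 T hT t) (z (projIcc 0 T hT t))) t := fun t =>
    (hc.integral_hasStrictDerivAt 0 t).hasDerivAt.const_add _
  have hZz : ∀ t ∈ Icc 0 T, z (projIcc 0 T hT t) = Z t := fun t ht => by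
    rw [hz, projIcc_of_mem hT ht]; rfl
  have hZc : Continuous Z := continuous_iff_continuousAt.2 fun t => (hZ t).continuousAt
  refine ⟨fun t => (Z t).1, fun t => (Z t).2, by simp [Z], by simp [Z],
    continuous_fst.comp hZc, continuous_snd.comp hZc, fun t ht => ?_⟩
  have h := hZ t
  rw [hZz t ht] at h
  exact ⟨h.fst, h.snd⟩

/-- Global existence of positive definite solutions of the Riccati equation
`V' = A V + V Aᵀ - V S V + R`. -/
lemma exists_riccati {n : ℕ} {T : ℝ} (hT : 0 ≤ T)
    (A : C(Icc (0 : ℝ) T, Matrix (Fin n) (Fin n) ℝ)) {S R S₀ : Matrix (Fin n) (Fin n) ℝ}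
    (hS : S.PosSemidef) (hR : R.PosSemidef) (hS₀ : S₀.PosDef) :
    ∃ V : C(Icc (0 : ℝ) T, Matrix (Fin n) (Fin n) ℝ), (∀ t, (V t).PosDef) ∧
      ∀ t : Icc (0 : ℝ) T, V t = S₀ + ∫ s in (0 : ℝ)..t,
        (A (projIcc 0 T hT s) * V (projIcc 0 T hT s)
          + V (projIcc 0 T hT s) * (A (projIcc 0 T hT s))ᵀ
          - V (projIcc 0 T hT s) * S * V (projIcc 0 T hT s) + R) := by
  obtain ⟨X, Y, hX0, hY0, hXc, hYc, hXY⟩ := exists_hamiltonian hT A S R S₀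
  have hXT : Continuous fun t => (X t)ᵀ := (transposeL n n).continuous.comp hXc
  have hYT : Continuous fun t => (Y t)ᵀ := (transposeL n n).continuous.comp hYc
  -- The terms with `A` cancel in `(Yᵀ X)' = Xᵀ S X + Yᵀ R Y ≥ 0`, so `Yᵀ X` dominates its initial
  -- value `S₀`.
  have hG : ∀ t ∈ Icc 0 T, ((Y t)ᵀ * X t).PosDef := by
    intro t ht
    have hd : ∀ s ∈ uIcc 0 t, HasDerivAt (fun s => (Y s)ᵀ * X s)
        ((X s)ᵀ * S * X s + (Y s)ᵀ * R * Y s) s := by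
      intro s hs
      rw [uIcc_of_le ht.1] at hs
      obtain ⟨h1, h2⟩ := hXY s ⟨hs.1, hs.2.trans ht.2⟩
      refine HasDerivAt.congr_deriv ((hasDerivAt_transpose h2).mul h1) ?_
      rw [Matrix.transpose_sub, Matrix.transpose_mul, Matrix.transpose_mul,
        Matrix.transpose_transpose, transpose_posSemidef_eq hS]
      noncomm_ring
    have hcont : Continuous fun s => (X s)ᵀ * S * X s + (Y s)ᵀ * R * Y s :=
      ((hXT.mul continuous_const).mul hXc).add ((hYT.mul continuous_const).mul hYc)
    have hint := intervalIntegral.integral_eq_sub_of_hasDerivAt hd (hcont.intervalIntegrable _ _)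
    have heq : (Y t)ᵀ * X t = S₀ + ∫ s in (0 : ℝ)..t, ((X s)ᵀ * S * X s + (Y s)ᵀ * R * Y s) := by
      rw [hint, hX0, hY0]; simp
    rw [heq]
    refine hS₀.add_posSemidef (posSemidef_intervalIntegral hcont ht.1 fun s _ => ?_)
    simp only [← Matrix.conjTranspose_eq_transpose_of_trivial]
    exact (hS.conjTranspose_mul_mul_same _).add (hR.conjTranspose_mul_mul_same _)
  -- This excludes blow-up of `X Y⁻¹`: a singular `Y` would make `Yᵀ X` singular.
  have hU : ∀ t ∈ Icc 0 T, IsUnit (Y t) := by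
    intro t ht
    have := (hG t ht).det_pos.ne'
    rw [Matrix.det_mul, Matrix.det_transpose] at this
    exact (Matrix.isUnit_iff_isUnit_det _).2 (left_ne_zero_of_mul this).isUnit
  have hV : ∀ t ∈ Icc 0 T, HasDerivAt (fun t => X t * (Y t)⁻¹)
      (A (projIcc 0 T hT t) * (X t * (Y t)⁻¹) + (X t * (Y t)⁻¹) * (A (projIcc 0 T hT t))ᵀ
        - (X t * (Y t)⁻¹) * S * (X t * (Y t)⁻¹) + R) t := by
    intro t ht
    obtain ⟨h1, h2⟩ := hXY t ht
    refine HasDerivAt.congr_deriv (h1.mul (hasDerivAt_matrix_inv h2 (hU t ht))) ?_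
    have hYY : Y t * (Y t)⁻¹ = 1 :=
      Matrix.mul_nonsing_inv _ ((Matrix.isUnit_iff_isUnit_det _).1 (hU t ht))
    set M := A (projIcc 0 T hT t)
    set W := (Y t)⁻¹
    have e1 : (M * X t + R * Y t) * W = M * (X t * W) + R := by
      rw [add_mul, mul_assoc, mul_assoc, hYY, mul_one]
    have e2 : X t * -(W * (S * X t - Mᵀ * Y t) * W)
        = X t * W * Mᵀ - X t * W * S * (X t * W) := by
      have : W * (S * X t - Mᵀ * Y t) * W = W * S * (X t * W) - W * Mᵀ * (Y t * W) := by
        noncomm_ring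
      rw [this, hYY]
      noncomm_ring
    rw [e1, e2]
    abel
  let V : C(Icc (0 : ℝ) T, Matrix (Fin n) (Fin n) ℝ) :=
    ⟨fun t => X t * (Y t)⁻¹, continuous_iff_continuousAt.2 fun t =>
      (hV t t.2).continuousAt.comp (f := Subtype.val) continuous_subtype_val.continuousAt⟩
  refine ⟨V, fun t => ?_, fun t => ?_⟩
  -- `X Y⁻¹ = (Y⁻¹)ᵀ (Yᵀ X) Y⁻¹` is congruent to a positive definite matrix.
  · have hu : IsUnit (Y t)⁻¹ :=
      (Matrix.isUnit_nonsing_inv_iff).2 (hU t t.2)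
    have h := (Matrix.IsUnit.posDef_star_left_conjugate_iff hu).2 (hG t t.2)
    convert h using 1
    change X t * (Y t)⁻¹ = _
    rw [Matrix.star_eq_conjTranspose, Matrix.conjTranspose_eq_transpose_of_trivial, ← mul_assoc,
      ← Matrix.transpose_mul,
      Matrix.mul_nonsing_inv _ ((Matrix.isUnit_iff_isUnit_det _).1 (hU t t.2)),
      Matrix.transpose_one, one_mul]
  · have hVc : Continuous fun s => V (projIcc 0 T hT s) := continuous_comp_projIcc hT V
    have hAc : Continuous fun s => A (projIcc 0 T hT s) := continuous_comp_projIcc hT A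
    have hcont := (((hAc.mul hVc).add (hVc.mul ((transposeL n n).continuous.comp hAc))).sub
      ((hVc.mul (continuous_const (y := S))).mul hVc)).add (continuous_const (y := R))
    have hd : ∀ s ∈ uIcc 0 (t : ℝ), HasDerivAt (fun t => X t * (Y t)⁻¹)
        (A (projIcc 0 T hT s) * V (projIcc 0 T hT s)
          + V (projIcc 0 T hT s) * (A (projIcc 0 T hT s))ᵀ
          - V (projIcc 0 T hT s) * S * V (projIcc 0 T hT s) + R) s := by
      intro s hs
      rw [uIcc_of_le t.2.1] at hs
      have hs' : s ∈ Icc 0 T := ⟨hs.1, hs.2.trans t.2.2⟩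
      have hVs : V (projIcc 0 T hT s) = X s * (Y s)⁻¹ := by rw [projIcc_of_mem hT hs']; rfl
      rw [hVs]
      exact hV s hs'
    have hint := intervalIntegral.integral_eq_sub_of_hasDerivAt hd (hcont.intervalIntegrable _ _)
    rw [hint, hX0, hY0]
    simp [V]

/-! ### Stability of Volterra equations -/

/-- Grönwall's inequality with an integrable source. -/
lemma le_exp_mul_integral_of_le_integral {u c : ℝ → ℝ} (hu : Continuous u) {K t : ℝ} (hK : 0 ≤ K)
    (hc : ∀ r ∈ Icc 0 t, 0 ≤ c r) (hci : IntervalIntegrable c volume 0 t)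
    (h : ∀ s ∈ Icc 0 t, u s ≤ ∫ r in (0 : ℝ)..s, (K * u r + c r)) :
    ∀ s ∈ Icc 0 t, u s ≤ Real.exp (K * t) * ∫ r in (0 : ℝ)..t, c r := by
  intro s hs
  have ht : 0 ≤ t := hs.1.trans hs.2
  have hsub : ∀ s ∈ Icc 0 t, IntervalIntegrable c volume 0 s := fun s hs =>
    hci.mono_set (by rw [uIcc_of_le hs.1, uIcc_of_le ht]; exact Icc_subset_Icc_right hs.2)
  have hI : 0 ≤ ∫ r in (0 : ℝ)..t, c r := intervalIntegral.integral_nonneg ht hc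
  -- The source, integrated over all of `[0, t]`, takes the place of the initial value, leaving `ε =
  -- 0`.
  have h1 := le_gronwallBound_of_le_integral hu (a := ∫ r in (0 : ℝ)..t, c r) (ε := 0) hK
    (t := t) (fun s hs => by
      refine (h s hs).trans ?_
      rw [intervalIntegral.integral_add (Continuous.intervalIntegrable (by fun_prop) _ _)
        (hsub s hs), add_comm]
      simp only [add_zero]
      gcongr
      exact intervalIntegral.integral_mono_interval le_rfl hs.1 hs.2
        ((ae_restrict_iff' measurableSet_Ioc).2 <| ae_of_all _ fun r hr => hc r ⟨hr.1.le, hr.2⟩)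
        hci) s hs
  rw [gronwallBound_ε0, mul_comm] at h1
  refine h1.trans ?_
  gcongr
  exact hs.2

variable {F : Type*} [NormedAddCommGroup F] [NormedSpace ℝ F] {T : ℝ}

/-- Stability of linear Volterra equations with respect to the coefficient. -/
lemma norm_sub_le_of_volterra (hT : 0 ≤ T) {a b : C(Icc (0 : ℝ) T, F →L[ℝ] F)}
    {f g : C(Icc (0 : ℝ) T, F)} {h : Icc (0 : ℝ) T → F} {t κ : ℝ} (hκ : 0 ≤ κ)
    (ha : ∀ s : Icc (0 : ℝ) T, (s : ℝ) ≤ t → ‖a s‖ ≤ κ)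
    (hf : ∀ s : Icc (0 : ℝ) T, (s : ℝ) ≤ t →
      f s = h s + ∫ r in (0 : ℝ)..s, a (projIcc 0 T hT r) (f (projIcc 0 T hT r)))
    (hg : ∀ s : Icc (0 : ℝ) T, (s : ℝ) ≤ t →
      g s = h s + ∫ r in (0 : ℝ)..s, b (projIcc 0 T hT r) (g (projIcc 0 T hT r)))
    (htT : t ≤ T) (s : Icc (0 : ℝ) T) (hs : (s : ℝ) ≤ t) :
    ‖f s - g s‖ ≤ Real.exp (κ * t) *
      ∫ r in (0 : ℝ)..t, ‖(a - b) (projIcc 0 T hT r) (g (projIcc 0 T hT r))‖ := by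
  have hab := continuous_clm_apply_projIcc hT (a - b) g
  have := le_exp_mul_integral_of_le_integral
    (u := fun r => ‖f (projIcc 0 T hT r) - g (projIcc 0 T hT r)‖)
    (c := fun r => ‖(a - b) (projIcc 0 T hT r) (g (projIcc 0 T hT r))‖)
    ((continuous_comp_projIcc hT f).sub (continuous_comp_projIcc hT g)).norm (t := t) hκ
    (fun _ _ => norm_nonneg _) (hab.norm.intervalIntegrable _ _) ?_ s ⟨s.2.1, hs⟩
  · simpa only [projIcc_val] using this
  · intro r hr
    have hr' : r ∈ Icc 0 T := ⟨hr.1, hr.2.trans htT⟩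
    rw [projIcc_of_mem hT hr', hf ⟨r, hr'⟩ hr.2, hg ⟨r, hr'⟩ hr.2, add_sub_add_left_eq_sub,
      ← intervalIntegral.integral_sub
        ((continuous_clm_apply_projIcc hT a f).intervalIntegrable _ _)
        ((continuous_clm_apply_projIcc hT b g).intervalIntegrable _ _)]
    refine intervalIntegral.norm_integral_le_of_norm_le hr.1 (ae_of_all _ fun v hv => ?_)
      (Continuous.intervalIntegrable
        ((continuous_const.mul ((continuous_comp_projIcc hT f).sub
          (continuous_comp_projIcc hT g)).norm).add hab.norm) _ _)
    set p := projIcc 0 T hT v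
    have hp : (p : ℝ) ≤ t := by
      have : p = ⟨v, hv.1.le, hv.2.trans hr'.2⟩ := projIcc_of_mem hT _
      rw [this]; exact hv.2.trans hr.2
    -- With this splitting only `a` enters the exponential rate and only `g` the source; hence `κ`
    -- is taken at `Q` while the size factors come from `F(U)`.
    have e : a p (f p) - b p (g p) = a p (f p - g p) + (a - b) p (g p) := by
      simp
    rw [e]
    refine (norm_add_le _ _).trans (add_le_add ?_ le_rfl)
    exact ((a p).le_opNorm _).trans (by gcongr; exact ha p hp)

/-- Two solutions of linear Volterra equations with the same data up to time `t` agree up to `t`. -/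
lemma eq_of_volterra (hT : 0 ≤ T) {a : C(Icc (0 : ℝ) T, F →L[ℝ] F)}
    {f g : C(Icc (0 : ℝ) T, F)} {h : Icc (0 : ℝ) T → F} {t : ℝ} (htT : t ≤ T)
    (hf : ∀ s : Icc (0 : ℝ) T, (s : ℝ) ≤ t →
      f s = h s + ∫ r in (0 : ℝ)..s, a (projIcc 0 T hT r) (f (projIcc 0 T hT r)))
    (hg : ∀ s : Icc (0 : ℝ) T, (s : ℝ) ≤ t →
      g s = h s + ∫ r in (0 : ℝ)..s, a (projIcc 0 T hT r) (g (projIcc 0 T hT r)))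
    (s : Icc (0 : ℝ) T) (hs : (s : ℝ) ≤ t) : f s = g s := by
  have := norm_sub_le_of_volterra hT (norm_nonneg a) (fun s _ => a.norm_coe_le_norm s) hf hg htT
    s hs
  simpa [sub_eq_zero] using this

/-- Moves a constant source between the integrand, where Grönwall and the Riccati equation have it,
and the inhomogeneity required by the Volterra form. -/
lemma add_integral_add_const [CompleteSpace F] {f : ℝ → F} (hf : Continuous f) (x R : F) (t : ℝ) :
    x + ∫ s in (0 : ℝ)..t, (f s + R) = (x + t • R) + ∫ s in (0 : ℝ)..t, f s := by
  rw [intervalIntegral.integral_add (hf.intervalIntegrable _ _)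
    (continuous_const.intervalIntegrable _ _), intervalIntegral.integral_const, sub_zero]
  abel

/-! ### Drift operators and the Lyapunov equation -/

/-- A matrix as an operator between Euclidean spaces. -/
def actL (k n : ℕ) : Matrix (Fin k) (Fin n) ℝ →L[ℝ] Vec n →L[ℝ] Vec k :=
  LinearMap.toContinuousLinearMap
    ((Matrix.toEuclideanLin (𝕜 := ℝ) (m := Fin k) (n := Fin n)).trans
      LinearMap.toContinuousLinearMap).toLinearMap

@[simp] lemma actL_apply {k n : ℕ} (M : Matrix (Fin k) (Fin n) ℝ) (x : Vec n) :
    actL k n M x = act M x := rfl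

lemma norm_actL {k n : ℕ} (M : Matrix (Fin k) (Fin n) ℝ) : ‖actL k n M‖ = ‖M‖ := rfl

/-- The operator path `t ↦ M_t` on vectors. -/
def vecDrift {d : ℕ} (M : C(Icc (0 : ℝ) T, Matrix (Fin d) (Fin d) ℝ)) :
    C(Icc (0 : ℝ) T, Vec d →L[ℝ] Vec d) :=
  ⟨fun t => actL d d (M t), (actL d d).continuous.comp M.continuous⟩

@[simp] lemma vecDrift_apply {d : ℕ} (M : C(Icc (0 : ℝ) T, Matrix (Fin d) (Fin d) ℝ))
    (t : Icc (0 : ℝ) T) : vecDrift M t = actL d d (M t) := rfl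

/-- The Lyapunov operator `V ↦ M V + V Mᵀ`. -/
def lyapunovL (d : ℕ) : Matrix (Fin d) (Fin d) ℝ →L[ℝ]
    Matrix (Fin d) (Fin d) ℝ →L[ℝ] Matrix (Fin d) (Fin d) ℝ :=
  mulL d + (mulL d).flip ∘L transposeL d d

@[simp] lemma lyapunovL_apply {d : ℕ} (M V : Matrix (Fin d) (Fin d) ℝ) :
    lyapunovL d M V = M * V + V * Mᵀ := rfl

/-- The factor `2`, one for each side of `V`, turns the rate `κ` of the vector equation into `2 κ`
for covariances. -/
lemma norm_lyapunovL_apply_le {d : ℕ} (M V : Matrix (Fin d) (Fin d) ℝ) :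
    ‖lyapunovL d M V‖ ≤ 2 * ‖M‖ * ‖V‖ := by
  rw [lyapunovL_apply]
  have h1 := norm_mul_le M V
  have h2 := norm_mul_le V Mᵀ
  rw [norm_transpose] at h2
  linarith [norm_add_le (M * V) (V * Mᵀ)]

lemma norm_lyapunovL_le {d : ℕ} (M : Matrix (Fin d) (Fin d) ℝ) : ‖lyapunovL d M‖ ≤ 2 * ‖M‖ :=
  ContinuousLinearMap.opNorm_le_bound _ (by positivity) (norm_lyapunovL_apply_le M)

/-- The operator path `t ↦ (V ↦ M_t V + V M_tᵀ)` on matrices. -/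
def lyapunovDrift {d : ℕ} (M : C(Icc (0 : ℝ) T, Matrix (Fin d) (Fin d) ℝ)) :
    C(Icc (0 : ℝ) T, Matrix (Fin d) (Fin d) ℝ →L[ℝ] Matrix (Fin d) (Fin d) ℝ) :=
  ⟨fun t => lyapunovL d (M t), (lyapunovL d).continuous.comp M.continuous⟩

@[simp] lemma lyapunovDrift_apply {d : ℕ} (M : C(Icc (0 : ℝ) T, Matrix (Fin d) (Fin d) ℝ))
    (t : Icc (0 : ℝ) T) : lyapunovDrift M t = lyapunovL d (M t) := rfl

/-- `V` solves the Lyapunov equation `V' = M V + V Mᵀ + R`, `V₀ = S₀`. -/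
def IsLyapunov {d : ℕ} (hT : 0 ≤ T) (M : C(Icc (0 : ℝ) T, Matrix (Fin d) (Fin d) ℝ))
    (R S₀ : Matrix (Fin d) (Fin d) ℝ) (V : C(Icc (0 : ℝ) T, Matrix (Fin d) (Fin d) ℝ)) : Prop :=
  ∀ t : Icc (0 : ℝ) T, V t = (S₀ + (t : ℝ) • R) + ∫ s in (0 : ℝ)..t,
    lyapunovDrift M (projIcc 0 T hT s) (V (projIcc 0 T hT s))

section Lyapunov

variable {d : ℕ} {hT : 0 ≤ T} {M N V W : C(Icc (0 : ℝ) T, Matrix (Fin d) (Fin d) ℝ)}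
  {R S₀ : Matrix (Fin d) (Fin d) ℝ}

/-- The constant `R` is put back under the integral, so that Grönwall charges it `(e^{2κt} - 1) /
(2κ)` and not `t e^{2κt}`. -/
lemma IsLyapunov.norm_le (hV : IsLyapunov hT M R S₀ V) {t κ : ℝ} (hκ : 0 ≤ κ) (htT : t ≤ T)
    (hM : ∀ s : Icc (0 : ℝ) T, (s : ℝ) ≤ t → ‖M s‖ ≤ κ) (s : Icc (0 : ℝ) T) (hs : (s : ℝ) ≤ t) :
    ‖V s‖ ≤ gronwallBound ‖S₀‖ (2 * κ) ‖R‖ t := by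
  have hc := continuous_clm_apply_projIcc hT (lyapunovDrift M) V
  have := norm_le_gronwallBound_of_eq_integral (f := fun r => V (projIcc 0 T hT r))
    (g := fun r => lyapunovDrift M (projIcc 0 T hT r) (V (projIcc 0 T hT r)) + R)
    (continuous_comp_projIcc hT V) (x₀ := S₀) (K := 2 * κ) (ε := ‖R‖) (t := t) (by positivity)
    le_rfl
    (fun r hr => ?_) (fun r hr => ?_) s ⟨s.2.1, hs⟩
  · rw [projIcc_val] at this
    exact this.trans (gronwallBound_mono (norm_nonneg _) (norm_nonneg _) (by positivity) hs)
  · have hr' : r ∈ Icc 0 T := ⟨hr.1, hr.2.trans htT⟩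
    rw [projIcc_of_mem hT hr']
    exact (hV ⟨r, hr'⟩).trans (add_integral_add_const hc S₀ R r).symm
  · have hr' : r ∈ Icc 0 T := ⟨hr.1, hr.2.trans htT⟩
    rw [projIcc_of_mem hT hr']
    refine (norm_add_le _ _).trans (add_le_add ?_ le_rfl)
    refine (norm_lyapunovL_apply_le _ _).trans ?_
    gcongr
    exact hM _ hr.2

lemma IsLyapunov.norm_sub_le (hV : IsLyapunov hT M R S₀ V) (hW : IsLyapunov hT N R S₀ W) {t κ : ℝ}
    (hκ : 0 ≤ κ) (htT : t ≤ T) (hM : ∀ s : Icc (0 : ℝ) T, (s : ℝ) ≤ t → ‖M s‖ ≤ κ)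
    (s : Icc (0 : ℝ) T) (hs : (s : ℝ) ≤ t) :
    ‖V s - W s‖ ≤ Real.exp (2 * κ * t) * ∫ r in (0 : ℝ)..t,
      ‖lyapunovL d (M (projIcc 0 T hT r) - N (projIcc 0 T hT r)) (W (projIcc 0 T hT r))‖ := by
  have := norm_sub_le_of_volterra hT (a := lyapunovDrift M) (b := lyapunovDrift N) (f := V)
    (g := W) (h := fun s => S₀ + (s : ℝ) • R) (κ := 2 * κ) (by positivity)
    (fun s hs => (norm_lyapunovL_le (M s)).trans (by have := hM s hs; linarith))
    (fun s _ => hV s) (fun s _ => hW s) htT s hs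
  simpa using this

/-- Used to identify the second moment of any solution in `𝒳` with a deterministic path. -/
lemma IsLyapunov.unique (hV : IsLyapunov hT M R S₀ V) (hW : IsLyapunov hT M R S₀ W) : V = W :=
  ContinuousMap.ext fun s =>
    eq_of_volterra hT (a := lyapunovDrift M) (h := fun s => S₀ + (s : ℝ) • R) le_rfl
      (fun s _ => hV s) (fun s _ => hW s) s s.2.2

end Lyapunov

/-! ### The drift `√Ricc(Q)` and the covariance equations -/

/-- The path `t ↦ √Ricc(Q_t)`. -/
def ricc {d m : ℕ} (A : Matrix (Fin d) (Fin d) ℝ) (H : Matrix (Fin m) (Fin d) ℝ)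
    (Q : C(Icc (0 : ℝ) T, Matrix (Fin d) (Fin d) ℝ)) : C(Icc (0 : ℝ) T, Matrix (Fin d) (Fin d) ℝ) :=
  ⟨fun t => sqrtRicc A H (Q t),
    continuous_const.sub ((Q.continuous.mul continuous_const).const_smul (1 / 2 : ℝ))⟩

section Ricc

variable {d m : ℕ} (A : Matrix (Fin d) (Fin d) ℝ) (H : Matrix (Fin m) (Fin d) ℝ)

@[simp] lemma ricc_apply (Q : C(Icc (0 : ℝ) T, Matrix (Fin d) (Fin d) ℝ)) (t : Icc (0 : ℝ) T) :
    ricc A H Q t = sqrtRicc A H (Q t) := rfl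

lemma sqrtRicc_sub (Q U : Matrix (Fin d) (Fin d) ℝ) :
    sqrtRicc A H Q - sqrtRicc A H U = -((1 / 2 : ℝ) • ((Q - U) * (Hᵀ * H))) := by
  rw [sqrtRicc, sqrtRicc, sub_sub_sub_cancel_left, ← smul_sub, ← sub_mul, ← smul_neg, ← neg_mul,
    neg_sub]

lemma norm_sqrtRicc_sub_le (Q U : Matrix (Fin d) (Fin d) ℝ) :
    ‖sqrtRicc A H Q - sqrtRicc A H U‖ ≤ ‖Hᵀ * H‖ / 2 * ‖Q - U‖ := by
  rw [sqrtRicc_sub, norm_neg, norm_smul]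
  have := norm_mul_le (Q - U) (Hᵀ * H)
  norm_num
  linarith

lemma norm_sqrtRicc_le (Q : Matrix (Fin d) (Fin d) ℝ) :
    ‖sqrtRicc A H Q‖ ≤ ‖A‖ + ‖Q‖ * ‖Hᵀ * H‖ / 2 := by
  have := norm_sqrtRicc_sub_le A H Q 0
  have h2 := norm_sub_norm_le (sqrtRicc A H Q) (sqrtRicc A H 0)
  have h3 : sqrtRicc A H 0 = A := by simp [sqrtRicc]
  rw [h3] at this h2
  rw [sub_zero] at this
  linarith

lemma posSemidef_transpose_mul_self : (Hᵀ * H).PosSemidef := by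
  rw [← Matrix.conjTranspose_eq_transpose_of_trivial]
  exact Matrix.posSemidef_conjTranspose_mul_self H

/-- Along solutions of the Riccati equation the two half-drifts combine into `-V HᵀH V`. -/
lemma lyapunovL_sqrtRicc_self {V : Matrix (Fin d) (Fin d) ℝ} (hV : Vᵀ = V) :
    lyapunovL d (sqrtRicc A H V) V = A * V + V * Aᵀ - V * (Hᵀ * H) * V := by
  have hS := transpose_posSemidef_eq (posSemidef_transpose_mul_self H)
  rw [lyapunovL_apply, sqrtRicc, Matrix.transpose_sub, Matrix.transpose_smul,
    Matrix.transpose_mul V,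
    hS, hV, sub_mul, mul_sub, Matrix.smul_mul, Matrix.mul_smul]
  rw [← mul_assoc V (Hᵀ * H) V]
  module

end Ricc

/-- The Lyapunov equation has a positive definite solution. -/
lemma exists_isLyapunov_posDef {d : ℕ} (hT : 0 ≤ T)
    (M : C(Icc (0 : ℝ) T, Matrix (Fin d) (Fin d) ℝ)) {R S₀ : Matrix (Fin d) (Fin d) ℝ}
    (hR : R.PosSemidef) (hS₀ : S₀.PosDef) :
    ∃ V, (∀ t, (V t).PosDef) ∧ IsLyapunov hT M R S₀ V := by
  -- The Lyapunov equation is the Riccati equation without quadratic term, so positivity is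
  -- inherited.
  obtain ⟨V, hV, hVe⟩ := exists_riccati hT M (S := 0) Matrix.PosSemidef.zero hR hS₀
  refine ⟨V, hV, fun t => ?_⟩
  have hc := continuous_clm_apply_projIcc hT (lyapunovDrift M) V
  rw [hVe t]
  simp only [mul_zero, zero_mul, sub_zero]
  exact add_integral_add_const hc S₀ R t

/-- The covariance equation of the mean-field process has a positive definite solution. -/
lemma exists_isLyapunov_ricc_self {d m : ℕ} (hT : 0 ≤ T) (A : Matrix (Fin d) (Fin d) ℝ)
    (H : Matrix (Fin m) (Fin d) ℝ) {R S₀ : Matrix (Fin d) (Fin d) ℝ}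
    (hR : R.PosSemidef) (hS₀ : S₀.PosDef) :
    ∃ V : C(Icc (0 : ℝ) T, Matrix (Fin d) (Fin d) ℝ), (∀ t, (V t).PosDef) ∧
      IsLyapunov hT (ricc A H V) R S₀ V := by
  obtain ⟨V, hV, hVe⟩ := exists_riccati hT (ContinuousMap.const _ A)
    (posSemidef_transpose_mul_self H) hR hS₀
  refine ⟨V, hV, fun t => ?_⟩
  have hc := continuous_clm_apply_projIcc hT (lyapunovDrift (ricc A H V)) V
  refine Eq.trans ?_ (add_integral_add_const hc S₀ R t)
  simp only [lyapunovDrift_apply, ricc_apply, ContinuousMap.const_apply,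
    lyapunovL_sqrtRicc_self A H (transpose_posSemidef_eq (hV _).posSemidef)] at hVe ⊢
  exact hVe t

/-! ### The running supremum `l2` -/

section SupNorms

variable {d : ℕ} (Q U : C(Icc (0 : ℝ) T, Matrix (Fin d) (Fin d) ℝ))

lemma bddAbove_l2 (t : ℝ) :
    BddAbove (range fun s : {s : Icc (0 : ℝ) T // (s : ℝ) ≤ t} => ‖Q s.1 - U s.1‖) :=
  ⟨‖Q - U‖, by rintro _ ⟨s, rfl⟩; exact (Q - U).norm_coe_le_norm s.1⟩

lemma norm_sub_le_l2 {t : ℝ} (s : Icc (0 : ℝ) T) (hs : (s : ℝ) ≤ t) : ‖Q s - U s‖ ≤ l2 t Q U :=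
  le_ciSup (bddAbove_l2 Q U t) ⟨s, hs⟩

lemma norm_le_l2_zero {t : ℝ} (s : Icc (0 : ℝ) T) (hs : (s : ℝ) ≤ t) : ‖Q s‖ ≤ l2 t Q 0 := by
  simpa using norm_sub_le_l2 Q 0 s hs

variable {Q U} in
lemma l2_le {t C : ℝ} (hT : 0 ≤ T) (ht : 0 ≤ t)
    (h : ∀ s : Icc (0 : ℝ) T, (s : ℝ) ≤ t → ‖Q s - U s‖ ≤ C) : l2 t Q U ≤ C :=
  haveI : Nonempty {s : Icc (0 : ℝ) T // (s : ℝ) ≤ t} := ⟨⟨⟨0, le_rfl, hT⟩, ht⟩⟩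
  ciSup_le fun s => h s.1 s.2

lemma l2_nonneg (t : ℝ) : 0 ≤ l2 t Q U := Real.iSup_nonneg fun _ => norm_nonneg _

/-- For `t < 0` the supremum is over the empty set and equals `0`, so monotonicity holds on all of
`ℝ`. It provides integrability in time without continuity. -/
lemma l2_mono : Monotone fun t => l2 t Q U := by
  intro s t hst
  exact Real.iSup_le (fun r => norm_sub_le_l2 Q U r.1 (r.2.trans hst)) (l2_nonneg Q U t)

lemma intervalIntegrable_l2 (a b : ℝ) : IntervalIntegrable (fun s => l2 s Q U) volume a b :=
  (l2_mono Q U).intervalIntegrable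

lemma integral_l2_nonneg {t : ℝ} (ht : 0 ≤ t) : 0 ≤ ∫ s in (0 : ℝ)..t, l2 s Q U :=
  intervalIntegral.integral_nonneg ht fun _ _ => l2_nonneg Q U _

end SupNorms

/-! ### Bounds for solutions of the Lyapunov equation -/

section Kappa

variable {d m : ℕ} (A : Matrix (Fin d) (Fin d) ℝ) (H : Matrix (Fin m) (Fin d) ℝ) (Q U : CovPath d T)

lemma kappa_nonneg (t : ℝ) : 0 ≤ kappa A H t Q := by
  have := l2_nonneg Q.1 0 t
  unfold kappa
  positivity

lemma norm_ricc_le_kappa {t : ℝ} (s : Icc (0 : ℝ) T) (hs : (s : ℝ) ≤ t) :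
    ‖ricc A H Q.1 s‖ ≤ kappa A H t Q := by
  refine (norm_sqrtRicc_le A H _).trans ?_
  unfold kappa
  gcongr
  exact norm_le_l2_zero Q.1 s hs

variable {hT : 0 ≤ T} {R S₀ : Matrix (Fin d) (Fin d) ℝ}
  {V W : C(Icc (0 : ℝ) T, Matrix (Fin d) (Fin d) ℝ)}

variable {A H Q U} in
lemma l2_zero_le_of_isLyapunov (hV : IsLyapunov hT (ricc A H Q.1) R S₀ V) {t : ℝ}
    (ht : t ∈ Icc 0 T) :
    l2 t V 0 ≤ Real.exp (2 * kappa A H t Q * t) * ‖S₀‖ + expQuot (kappa A H t Q) t * ‖R‖ := by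
  refine l2_le hT ht.1 fun s hs => ?_
  rw [ContinuousMap.zero_apply, sub_zero]
  refine (hV.norm_le (kappa_nonneg A H Q t) ht.2 (norm_ricc_le_kappa A H Q) s hs).trans
    (le_of_eq ?_)
  -- The two definitions split on `2 κ = 0` and on `κ = 0` respectively.
  rw [gronwallBound, expQuot]
  split_ifs with h1 h2 h2
  · rw [h1]; simp; ring
  · exact absurd (by linarith) h2
  · exact absurd (by rw [h2]; ring) h1
  · ring

-- The stability estimate has rate `2 κ` and source at most `2 · ½ ‖HᵀH‖ l_{2,r}(Q, U) ‖W_r‖`; the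
-- `2` of the Lyapunov operator cancels the `½` of the drift.
variable {A H Q U} in
lemma l2_le_of_isLyapunov (hV : IsLyapunov hT (ricc A H Q.1) R S₀ V)
    (hW : IsLyapunov hT (ricc A H U.1) R S₀ W) {t : ℝ} (ht : t ∈ Icc 0 T) :
    l2 t V W ≤ Real.exp (2 * kappa A H t Q * t) * ‖Hᵀ * H‖ * l2 t W 0
      * ∫ s in (0 : ℝ)..t, l2 s Q.1 U.1 := by
  refine l2_le hT ht.1 fun s hs => ?_
  refine (hV.norm_sub_le hW (kappa_nonneg A H Q t) ht.2 (norm_ricc_le_kappa A H Q) s hs).trans ?_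
  rw [mul_assoc (Real.exp _), mul_assoc (Real.exp _)]
  refine mul_le_mul_of_nonneg_left ?_ (Real.exp_pos _).le
  rw [← intervalIntegral.integral_const_mul]
  refine intervalIntegral.integral_mono_on ht.1
    (Continuous.intervalIntegrable ?_ _ _) ((intervalIntegrable_l2 _ _ _ _).const_mul _)
    fun r hr => ?_
  · exact (((lyapunovL d).continuous.comp ((continuous_comp_projIcc hT (ricc A H Q.1)).sub
      (continuous_comp_projIcc hT (ricc A H U.1)))).clm_apply (continuous_comp_projIcc hT W)).norm
  · have hr' : r ∈ Icc 0 T := ⟨hr.1, hr.2.trans ht.2⟩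
    rw [projIcc_of_mem hT hr']
    refine (norm_lyapunovL_apply_le _ _).trans ?_
    have h1 := norm_sqrtRicc_sub_le A H (Q.1 ⟨r, hr'⟩) (U.1 ⟨r, hr'⟩)
    have h2 := norm_sub_le_l2 Q.1 U.1 ⟨r, hr'⟩ le_rfl
    have h3 := norm_le_l2_zero W ⟨r, hr'⟩ hr.2
    have h4 : ‖ricc A H Q.1 ⟨r, hr'⟩ - ricc A H U.1 ⟨r, hr'⟩‖ ≤ ‖Hᵀ * H‖ / 2 * l2 r Q.1 U.1 :=
      h1.trans (by gcongr)
    calc _ ≤ 2 * (‖Hᵀ * H‖ / 2 * l2 r Q.1 U.1) * l2 t W 0 := by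
          have := l2_nonneg Q.1 U.1 r
          gcongr
      _ = _ := by ring

end Kappa

/-! ### Measurability of path-valued random variables -/

section Measurability

variable {Ω : Type*} {T : ℝ} {F : Type*} [NormedAddCommGroup F] [NormedSpace ℝ F]

/-- The path `f` frozen at time `t`. -/
def stopAt {X : Type*} [TopologicalSpace X] (t : Icc (0 : ℝ) T) (f : C(Icc (0 : ℝ) T, X)) :
    C(Icc (0 : ℝ) T, X) :=
  f.comp ⟨fun s => min s t, by fun_prop⟩

@[simp] lemma stopAt_apply {X : Type*} [TopologicalSpace X] (t : Icc (0 : ℝ) T)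
    (f : C(Icc (0 : ℝ) T, X)) (s : Icc (0 : ℝ) T) : stopAt t f s = f (min s t) := rfl

lemma stopAt_right {X : Type*} [TopologicalSpace X] (hT : 0 ≤ T)
    (f : C(Icc (0 : ℝ) T, X)) :
    stopAt ⟨T, right_mem_Icc.2 hT⟩ f = f := by
  ext s
  rw [stopAt_apply, min_eq_left (show s ≤ ⟨T, right_mem_Icc.2 hT⟩ from s.2.2)]

/-- A frozen path is a uniform limit of paths depending on finitely many of its values. -/
lemma exists_tendsto_stopAt (F : Type*) [NormedAddCommGroup F] [NormedSpace ℝ F]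
    (t : Icc (0 : ℝ) T) :
    ∃ (p : ∀ n : ℕ, Fin (n + 1) → Icc (0 : ℝ) T) (w : ∀ n : ℕ, Fin (n + 1) → C(Icc (0 : ℝ) T, ℝ)),
      (∀ n k, p n k ≤ t) ∧ ∀ f : C(Icc (0 : ℝ) T, F),
        Tendsto (fun n => ∑ k, w n k • ContinuousMap.const (Icc (0 : ℝ) T) (f (p n k))) atTop
          (𝓝 (stopAt t f)) := by
  have ht := t.2
  -- Bernstein approximation of `f` on `[0, t]` rescaled to `[0, 1]`; `ψ ∘ φ` is `s ↦ min s t`. For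
  -- `t = 0` the convention `s / 0 = 0` does no harm, since `ψ` multiplies by `t`.
  let φ : C(Icc (0 : ℝ) T, unitInterval) :=
    ⟨fun s => projIcc 0 1 zero_le_one ((s : ℝ) / t), continuous_projIcc.comp (by fun_prop)⟩
  let ψ : C(unitInterval, Icc (0 : ℝ) T) :=
    ⟨fun u => ⟨u * t, mul_nonneg u.2.1 ht.1, (mul_le_of_le_one_left ht.1 u.2.2).trans ht.2⟩,
      by fun_prop⟩
  refine ⟨fun n k => ψ (bernstein.z k), fun n k => (bernstein n k).comp φ, fun n k => ?_,
    fun f => ?_⟩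
  · exact Subtype.coe_le_coe.1 (mul_le_of_le_one_left ht.1 (bernstein.z k).2.2)
  · have h := (ContinuousMap.continuous_precomp φ).continuousAt.tendsto.comp
      (bernsteinApproximation_uniform (f.comp ψ))
    convert h using 1
    · ext n s
      simp [bernsteinApproximation.apply, ContinuousMap.sum_apply]
    · congr 1
      ext s
      simp only [stopAt_apply, ContinuousMap.comp_apply]
      congr 1
      apply Subtype.ext
      have hs := s.2
      change min (s : ℝ) t = (projIcc (0 : ℝ) 1 zero_le_one ((s : ℝ) / t) : ℝ) * t
      rw [coe_projIcc]
      rcases ht.1.eq_or_lt with h0 | h0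
      · rw [← h0, mul_zero, min_eq_right hs.1]
      · rw [max_eq_right (le_min zero_le_one (div_nonneg hs.1 ht.1)), min_comm (1 : ℝ),
          min_mul_of_nonneg _ _ ht.1, div_mul_cancel₀ _ h0.ne', one_mul]

/-- Almost everywhere limits preserve almost everywhere strong measurability with respect to a
sub-σ-algebra. -/
lemma aestronglyMeasurable_of_tendsto {E : Type*} [TopologicalSpace E] [Nonempty E]
    [TopologicalSpace.IsCompletelyMetrizableSpace E] {m m₀ : MeasurableSpace Ω} {P : Measure Ω}
    {f : ℕ → Ω → E} {g : Ω → E} (hf : ∀ n, AEStronglyMeasurable[m] (f n) P)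
    (h : ∀ᵐ ω ∂P, Tendsto (fun n => f n ω) atTop (𝓝 (g ω))) : AEStronglyMeasurable[m] g P := by
  choose f' hf' hff' using hf
  refine ⟨fun ω => limUnder atTop fun n => f' n ω,
    @StronglyMeasurable.limUnder ℕ Ω E m _ _ atTop _ f' _ _ hf', ?_⟩
  filter_upwards [h, ae_all_iff.2 hff'] with ω h1 h2
  simp only [h2] at h1
  exact h1.limUnder_eq.symm

/-- The Bernstein sums use only values at times `s ≤ t` and converge in sup norm, so measurability
at single times passes to the stopped path as a random element of `C([0, T])`. -/
lemma aestronglyMeasurable_stopAt [CompleteSpace F] {m m₀ : MeasurableSpace Ω} {P : Measure Ω}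
    {X : Ω → C(Icc (0 : ℝ) T, F)} {t : Icc (0 : ℝ) T}
    (hX : ∀ s ≤ t, AEStronglyMeasurable[m] (fun ω => X ω s) P) :
    AEStronglyMeasurable[m] (fun ω => stopAt t (X ω)) P := by
  obtain ⟨p, w, hp, hlim⟩ := exists_tendsto_stopAt F t
  refine aestronglyMeasurable_of_tendsto
    (f := fun n ω => ∑ k, w n k • ContinuousMap.const (Icc (0 : ℝ) T) (X ω (p n k)))
    (fun n => ?_) (ae_of_all _ fun ω => hlim (X ω))
  choose g hg hXg using fun k => hX (p n k) (hp n k)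
  refine ⟨fun ω => ∑ k, w n k • ContinuousMap.const (Icc (0 : ℝ) T) (g k ω), ?_, ?_⟩
  · refine Finset.stronglyMeasurable_fun_sum _ fun k _ => ?_
    have hc : Continuous fun x : F => w n k • ContinuousMap.const (Icc (0 : ℝ) T) x := by
      refine ContinuousMap.continuous_of_continuous_uncurry _ ?_
      simp only [Function.uncurry_def, ContinuousMap.smul_apply', ContinuousMap.const_apply]
      fun_prop
    exact hc.comp_stronglyMeasurable (hg k)
  · filter_upwards [ae_all_iff.2 hXg] with ω hω
    simp only [hω]

lemma aestronglyMeasurable_path [CompleteSpace F] [MeasurableSpace Ω] {P : Measure Ω} (hT : 0 ≤ T)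
    {X : Ω → C(Icc (0 : ℝ) T, F)} (hX : ∀ s, AEStronglyMeasurable (fun ω => X ω s) P) :
    AEStronglyMeasurable X P := by
  have := aestronglyMeasurable_stopAt (X := X) (t := ⟨T, right_mem_Icc.2 hT⟩) fun s _ => hX s
  simpa only [stopAt_right hT] using this

end Measurability

/-! ### Gaussian limits and Fernique's theorem -/

section Gaussian

variable {Ω : Type*} [MeasurableSpace Ω] {P : Measure Ω}

lemma charFun_map_real {X : Ω → ℝ} (hX : AEMeasurable X P) (t : ℝ) :
    charFun (P.map X) t = ∫ ω, Complex.exp (t * X ω * Complex.I) ∂P := by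
  rw [charFun_apply_real, integral_map hX (by fun_prop)]

variable [IsProbabilityMeasure P]

/-- Almost sure limits of centered Gaussian variables are Gaussian. -/
lemma exists_map_eq_gaussianReal_of_tendsto {X : ℕ → Ω → ℝ} {Y : Ω → ℝ} {v : ℕ → ℝ≥0}
    (hX : ∀ n, AEMeasurable (X n) P) (hY : AEMeasurable Y P)
    (hlaw : ∀ n, P.map (X n) = gaussianReal 0 (v n))
    (h : ∀ᵐ ω ∂P, Tendsto (fun n => X n ω) atTop (𝓝 (Y ω))) :
    ∃ u : ℝ≥0, P.map Y = gaussianReal 0 u := by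
  have : IsProbabilityMeasure (P.map Y) := Measure.isProbabilityMeasure_map hY
  have hconv : ∀ t : ℝ, Tendsto (fun n => ((Real.exp (-(v n) / 2) ^ (t ^ 2) : ℝ) : ℂ)) atTop
      (𝓝 (charFun (P.map Y) t)) := by
    intro t
    have h1 : ∀ n, ((Real.exp (-(v n) / 2) ^ (t ^ 2) : ℝ) : ℂ) = charFun (P.map (X n)) t := by
      intro n
      rw [hlaw n, charFun_gaussianReal, ← Real.exp_mul]
      push_cast
      congr 1
      ring
    simp_rw [h1, charFun_map_real (hX _), charFun_map_real hY]
    refine tendsto_integral_of_dominated_convergence (fun _ => 1) (fun n => ?_)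
      (integrable_const _) (fun n => ae_of_all _ fun ω => ?_) ?_
    · exact Continuous.comp_aestronglyMeasurable (g := fun x : ℝ => Complex.exp (t * x * Complex.I))
        (by fun_prop) (hX n).aestronglyMeasurable
    · rw [← Complex.ofReal_mul, Complex.norm_exp_ofReal_mul_I]
    · filter_upwards [h] with ω hω
      have hc : Continuous fun x : ℝ => Complex.exp (t * x * Complex.I) := by fun_prop
      exact (hc.tendsto _).comp hω
  -- The characteristic function at `1` supplies a limit `c` of `e^{-v_n/2}`, so no prior bound on
  -- the variances is needed. The limit variance will be `-2 log c`.
  obtain ⟨c, hc⟩ : ∃ c : ℝ, Tendsto (fun n => Real.exp (-(v n) / 2)) atTop (𝓝 c) := by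
    refine ⟨(charFun (P.map Y) 1).re, ?_⟩
    refine ((Complex.continuous_re.tendsto _).comp (hconv 1)).congr fun n => ?_
    rw [Function.comp_apply, Complex.ofReal_re, one_pow, Real.rpow_one]
  have hc0 : 0 ≤ c := ge_of_tendsto' hc fun n => (Real.exp_pos _).le
  have hc1 : c ≤ 1 := le_of_tendsto' hc fun n => Real.exp_le_one_iff.2 (by
    have := (v n).2; simp only [NNReal.val_eq_coe] at this; linarith)
  have hform : ∀ t : ℝ, t ≠ 0 → charFun (P.map Y) t = ((c ^ (t ^ 2) : ℝ) : ℂ) := by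
    intro t ht
    refine tendsto_nhds_unique (hconv t) ?_
    exact (Complex.continuous_ofReal.tendsto _).comp
      (hc.rpow_const (Or.inr (by positivity)))
  -- If `c = 0`, the limiting characteristic function would vanish off the origin, against its
  -- continuity and its value `1` there.
  have hcpos : 0 < c := by
    refine hc0.lt_of_ne fun h0 => ?_
    have h1 : Tendsto (charFun (P.map Y)) (𝓝[≠] 0) (𝓝 (charFun (P.map Y) 0)) :=
      (continuous_charFun.tendsto 0).mono_left nhdsWithin_le_nhds
    have h2 : Tendsto (charFun (P.map Y)) (𝓝[≠] 0) (𝓝 0) := by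
      refine tendsto_const_nhds.congr' ?_
      filter_upwards [self_mem_nhdsWithin] with t ht
      rw [hform t ht, ← h0, Real.zero_rpow (pow_ne_zero 2 ht), Complex.ofReal_zero]
    have h3 := tendsto_nhds_unique h1 h2
    simp at h3
  have hlog : 0 ≤ -2 * Real.log c := by
    have := Real.log_nonpos hc0 hc1
    linarith
  refine ⟨(-2 * Real.log c).toNNReal, Measure.ext_of_charFun (funext fun t => ?_)⟩
  rw [charFun_gaussianReal]
  rcases eq_or_ne t 0 with rfl | ht
  · simp
  · rw [hform t ht, Real.rpow_def_of_pos hcpos]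
    push_cast
    congr 1
    rw [Real.coe_toNNReal _ hlog]
    push_cast
    ring

variable {T : ℝ}

/-- A continuous centered Gaussian path has a square integrable supremum (Fernique). -/
lemma memLp_two_of_isGaussianProcess {ι : Type*} (hT : 0 ≤ T) {B : ι → Ω → ℝ}
    (hB : IsGaussianProcess B P) (hmean : ∀ i, P[B i] = 0) (τ : Icc (0 : ℝ) T → ι)
    {b : Ω → C(Icc (0 : ℝ) T, ℝ)} (hb : ∀ t, (fun ω => b ω t) =ᵐ[P] B (τ t)) : MemLp b 2 P := by
  classical
  have hBm : ∀ i, AEMeasurable (B i) P := fun i => (hB.hasGaussianLaw_eval i).aemeasurable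
  have hbm : AEStronglyMeasurable b P := aestronglyMeasurable_path hT fun s =>
    ((hBm _).congr (hb s).symm).aestronglyMeasurable
  let _ : MeasurableSpace C(Icc (0 : ℝ) T, ℝ) := borel _
  have : BorelSpace C(Icc (0 : ℝ) T, ℝ) := ⟨rfl⟩
  have hbA : AEMeasurable b P := hbm.aemeasurable
  obtain ⟨p, w, -, hlim⟩ := exists_tendsto_stopAt ℝ ⟨T, right_mem_Icc.2 hT⟩
  simp only [stopAt_right hT] at hlim
  -- A continuous functional of the path is an almost sure limit of finite combinations of the `B
  -- i`, which are centered Gaussian. Gaussianity of the law in `C([0, T])` then gives the moment of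
  -- the sup norm.
  have hG : IsGaussian (P.map b) := by
    refine isGaussian_of_map_eq_gaussianReal fun L => ?_
    have hLb : AEMeasurable (fun ω => L (b ω)) P := L.continuous.measurable.comp_aemeasurable hbA
    have hsum : ∀ n, HasGaussianLaw (fun ω => ∑ k, L (w n k) * B (τ (p n k)) ω) P := by
      intro n
      let I : Finset ι := Finset.univ.image fun k => τ (p n k)
      have hI : ∀ k, τ (p n k) ∈ I := fun k => Finset.mem_image_of_mem _ (Finset.mem_univ k)
      let Λ : (I → ℝ) →L[ℝ] ℝ :=
        ∑ k, L (w n k) • ContinuousLinearMap.proj (R := ℝ) (φ := fun _ : I => ℝ) ⟨_, hI k⟩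
      have := (hB.hasGaussianLaw I).map Λ
      have e : (fun ω => ∑ k, L (w n k) * B (τ (p n k)) ω) =
          Λ ∘ fun ω => I.restrict fun i => B i ω := by
        ext ω
        simp [Λ]
      rw [e]
      exact this
    have hsum0 : ∀ n, ∫ ω, ∑ k, L (w n k) * B (τ (p n k)) ω ∂P = 0 := by
      intro n
      rw [integral_finsetSum _ fun k _ =>
        (hB.hasGaussianLaw_eval (τ (p n k))).integrable.const_mul _]
      simp [integral_const_mul, hmean]
    have hlaw : ∀ n, ∃ v : ℝ≥0, P.map (fun ω => ∑ k, L (w n k) * B (τ (p n k)) ω)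
        = gaussianReal 0 v := by
      intro n
      have h := IsGaussian.eq_gaussianReal _ (hsum n).isGaussian_map
      rw [integral_map (hsum n).aemeasurable (by fun_prop)] at h
      simp only [id, hsum0 n] at h
      exact ⟨_, h⟩
    choose v hv using hlaw
    obtain ⟨u, hu⟩ := exists_map_eq_gaussianReal_of_tendsto (fun n => (hsum n).aemeasurable) hLb hv
      (by
        filter_upwards [ae_all_iff.2 fun n : ℕ => ae_all_iff.2 fun k => hb (p n k)] with ω hω
        have := (L.continuous.tendsto _).comp (hlim (b ω))
        refine this.congr fun n => ?_
        simp only [Function.comp_apply, map_sum]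
        refine Finset.sum_congr rfl fun k _ => ?_
        rw [← hω n k, show w n k • ContinuousMap.const (Icc (0 : ℝ) T) (b ω (p n k))
          = (b ω (p n k)) • w n k by ext; simp [mul_comm], map_smul, smul_eq_mul, mul_comm])
    exact ⟨0, u, by
      rw [AEMeasurable.map_map_of_aemeasurable L.continuous.aemeasurable hbA]; exact hu⟩
  exact HasGaussianLaw.memLp_two ⟨hG⟩

end Gaussian

/-! ### Outer products and moment paths -/

/-- The outer product `(x, z) ↦ x zᵀ`. -/
def outerL (k n : ℕ) : Vec k →L[ℝ] Vec n →L[ℝ] Matrix (Fin k) (Fin n) ℝ :=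
  LinearMap.toContinuousLinearMap
    (LinearMap.toContinuousLinearMap.toLinearMap ∘ₗ
      LinearMap.mk₂ ℝ (fun (x : Vec k) (z : Vec n) => Matrix.vecMulVec x.ofLp z.ofLp)
        (fun _ _ _ => Matrix.add_vecMulVec _ _ _) (fun _ _ _ => Matrix.smul_vecMulVec _ _ _)
        (fun _ _ _ => Matrix.vecMulVec_add _ _ _) (fun _ _ _ => Matrix.vecMulVec_smul _ _ _))

section Outer

variable {k n l : ℕ}

lemma outerL_apply (x : Vec k) (z : Vec n) (i : Fin k) (j : Fin n) :
    outerL k n x z i j = x i * z j := rfl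

lemma outerL_act_left (M : Matrix (Fin l) (Fin k) ℝ) (x : Vec k) (z : Vec n) :
    outerL l n (act M x) z = M * outerL k n x z :=
  (Matrix.mul_vecMulVec M x.ofLp z.ofLp).symm

lemma transpose_outerL (x : Vec k) (z : Vec n) : (outerL k n x z)ᵀ = outerL n k z x :=
  Matrix.transpose_vecMulVec _ _

end Outer

variable {T : ℝ}

/-- The pointwise application of a bilinear map to two paths. -/
def pathBilin {E F G : Type*} [NormedAddCommGroup E] [NormedSpace ℝ E] [NormedAddCommGroup F]
    [NormedSpace ℝ F] [NormedAddCommGroup G] [NormedSpace ℝ G] (T : ℝ) (b : E →L[ℝ] F →L[ℝ] G) :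
    C(Icc (0 : ℝ) T, E) →L[ℝ] C(Icc (0 : ℝ) T, F) →L[ℝ] C(Icc (0 : ℝ) T, G) :=
  LinearMap.mkContinuous₂
    (LinearMap.mk₂ ℝ (fun (x : C(Icc (0 : ℝ) T, E)) (z : C(Icc (0 : ℝ) T, F)) =>
        (⟨fun t => b (x t) (z t), by fun_prop⟩ : C(Icc (0 : ℝ) T, G)))
      (fun _ _ _ => by ext1 t; simp) (fun _ _ _ => by ext1 t; simp)
      (fun _ _ _ => by ext1 t; simp) (fun _ _ _ => by ext1 t; simp))
    ‖b‖ fun x z => by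
      rw [ContinuousMap.norm_le _ (by positivity)]
      intro t
      refine (b.le_opNorm₂ (x t) (z t)).trans ?_
      gcongr
      · exact x.norm_coe_le_norm t
      · exact z.norm_coe_le_norm t

/-- The pointwise outer product of two paths. -/
def pathOuter (T : ℝ) (k n : ℕ) : C(Icc (0 : ℝ) T, Vec k) →L[ℝ] C(Icc (0 : ℝ) T, Vec n) →L[ℝ]
    C(Icc (0 : ℝ) T, Matrix (Fin k) (Fin n) ℝ) :=
  pathBilin T (outerL k n)

@[simp] lemma pathOuter_apply {k n : ℕ} (x : C(Icc (0 : ℝ) T, Vec k))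
    (z : C(Icc (0 : ℝ) T, Vec n)) (t : Icc (0 : ℝ) T) :
    pathOuter T k n x z t = outerL k n (x t) (z t) := rfl

section Moments

variable {Ω : Type*} [MeasurableSpace Ω] {P : Measure Ω} {k n : ℕ}

lemma integrable_outerL {x : Ω → Vec k} {z : Ω → Vec n} (hx : MemLp x 2 P) (hz : MemLp z 2 P) :
    Integrable (fun ω => outerL k n (x ω) (z ω)) P :=
  memLp_one_iff_integrable.1 ((outerL k n).memLp_of_bilin 1 hx hz)

/-- Integrability in the path space, rather than at each time, lets expectation commute with time
integrals because these are bounded linear maps; Fubini is not needed. -/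
lemma integrable_pathOuter {X : Ω → C(Icc (0 : ℝ) T, Vec k)} {Z : Ω → C(Icc (0 : ℝ) T, Vec n)}
    (hX : MemLp X 2 P) (hZ : MemLp Z 2 P) :
    Integrable (fun ω => pathOuter T k n (X ω) (Z ω)) P :=
  memLp_one_iff_integrable.1 ((pathOuter T k n).memLp_of_bilin 1 hX hZ)

lemma memLp_eval {F : Type*} [NormedAddCommGroup F] [NormedSpace ℝ F]
    {X : Ω → C(Icc (0 : ℝ) T, F)} (hX : MemLp X 2 P) (t : Icc (0 : ℝ) T) :
    MemLp (fun ω => X ω t) 2 P :=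
  ContinuousLinearMap.comp_memLp' (ContinuousMap.evalCLM ℝ t : C(Icc (0 : ℝ) T, F) →L[ℝ] F) hX

lemma memLp_const_path {F : Type*} [NormedAddCommGroup F] [NormedSpace ℝ F] {z : Ω → F}
    (hz : MemLp z 2 P) : MemLp (fun ω => ContinuousMap.const (Icc (0 : ℝ) T) (z ω)) 2 P := by
  refine hz.of_le ?_ (ae_of_all _ fun ω => ?_)
  · have : Continuous fun x : F => ContinuousMap.const (Icc (0 : ℝ) T) x :=
      ContinuousMap.continuous_of_continuous_uncurry _ continuous_fst
    exact this.comp_aestronglyMeasurable hz.1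
  · rw [ContinuousMap.norm_le _ (norm_nonneg _)]
    exact fun _ => le_rfl

/-- The path `t ↦ E[X_t Z_tᵀ]`. -/
def crossMoment (P : Measure Ω) (X : Ω → C(Icc (0 : ℝ) T, Vec k))
    (Z : Ω → C(Icc (0 : ℝ) T, Vec n)) : C(Icc (0 : ℝ) T, Matrix (Fin k) (Fin n) ℝ) :=
  ∫ ω, pathOuter T k n (X ω) (Z ω) ∂P

lemma crossMoment_apply {X : Ω → C(Icc (0 : ℝ) T, Vec k)} {Z : Ω → C(Icc (0 : ℝ) T, Vec n)}
    (hX : MemLp X 2 P) (hZ : MemLp Z 2 P) (t : Icc (0 : ℝ) T) :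
    crossMoment P X Z t = ∫ ω, outerL k n (X ω t) (Z ω t) ∂P :=
  ((ContinuousMap.evalCLM ℝ t).integral_comp_comm (integrable_pathOuter hX hZ)).symm

end Moments

/-! ### The product rule for solutions -/

section Drift

variable {d : ℕ}

/-- The operator path `t ↦ (Z ↦ M_t Z)`. -/
def mulDrift (M : C(Icc (0 : ℝ) T, Matrix (Fin d) (Fin d) ℝ)) :
    C(Icc (0 : ℝ) T, Matrix (Fin d) (Fin d) ℝ →L[ℝ] Matrix (Fin d) (Fin d) ℝ) :=
  ⟨fun t => mulL d (M t), (mulL d).continuous.comp M.continuous⟩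

/-- Symmetrization `Z ↦ Z + Zᵀ`. -/
def symL (d : ℕ) : Matrix (Fin d) (Fin d) ℝ →L[ℝ] Matrix (Fin d) (Fin d) ℝ :=
  ContinuousLinearMap.id ℝ _ + transposeL d d

@[simp] lemma symL_apply (Z : Matrix (Fin d) (Fin d) ℝ) : symL d Z = Z + Zᵀ := rfl

variable (hT : 0 ≤ T) (M : C(Icc (0 : ℝ) T, Matrix (Fin d) (Fin d) ℝ))

/-- `Z ↦ ∫₀ᵗ M_s Z_s ds` as a continuous linear map. -/
def intMul (t : Icc (0 : ℝ) T) : C(Icc (0 : ℝ) T, Matrix (Fin d) (Fin d) ℝ) →L[ℝ]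
    Matrix (Fin d) (Fin d) ℝ :=
  ContinuousMap.evalCLM ℝ t ∘L volterra hT (mulDrift M)

lemma intMul_apply (t : Icc (0 : ℝ) T) (Z : C(Icc (0 : ℝ) T, Matrix (Fin d) (Fin d) ℝ)) :
    intMul hT M t Z = ∫ s in (0 : ℝ)..t, M (projIcc 0 T hT s) * Z (projIcc 0 T hT s) := rfl

/-- `V ↦ ∫₀ᵗ (M_s V_s + V_s M_sᵀ) ds` as a continuous linear map. -/
def intLyapunov (t : Icc (0 : ℝ) T) : C(Icc (0 : ℝ) T, Matrix (Fin d) (Fin d) ℝ) →L[ℝ]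
    Matrix (Fin d) (Fin d) ℝ :=
  ContinuousMap.evalCLM ℝ t ∘L volterra hT (lyapunovDrift M)

lemma intLyapunov_apply (t : Icc (0 : ℝ) T) (Z : C(Icc (0 : ℝ) T, Matrix (Fin d) (Fin d) ℝ)) :
    intLyapunov hT M t Z = ∫ s in (0 : ℝ)..t,
      lyapunovL d (M (projIcc 0 T hT s)) (Z (projIcc 0 T hT s)) := rfl

variable {M} {x n : C(Icc (0 : ℝ) T, Vec d)} {x₀ : Vec d}

/-- Outer product of a solution with a fixed vector. -/
lemma outerL_solution
    (hx : ∀ t : Icc (0 : ℝ) T, x t = (x₀ + n t)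
      + ∫ s in (0 : ℝ)..t, vecDrift M (projIcc 0 T hT s) (x (projIcc 0 T hT s)))
    (z : Vec d) (t : Icc (0 : ℝ) T) :
    outerL d d (x t) z = outerL d d x₀ z + outerL d d (n t) z
      + intMul hT M t (pathOuter T d d x (ContinuousMap.const _ z)) := by
  have hc := continuous_clm_apply_projIcc hT (vecDrift M) x
  have hi : IntervalIntegrable
      (fun s => vecDrift M (projIcc 0 T hT s) (x (projIcc 0 T hT s))) volume 0 (t : ℝ) :=
    hc.intervalIntegrable _ _
  have h := ((outerL d d).flip z).intervalIntegral_comp_comm hi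
  simp only [ContinuousLinearMap.flip_apply, vecDrift_apply, actL_apply, outerL_act_left] at h
  rw [hx t, map_add, map_add, add_apply, add_apply]
  congr 1
  exact h.symm

/-- The product rule for the outer product of a solution with itself. -/
lemma outerL_solution_self
    (hx : ∀ t : Icc (0 : ℝ) T, x t = (x₀ + n t)
      + ∫ s in (0 : ℝ)..t, vecDrift M (projIcc 0 T hT s) (x (projIcc 0 T hT s)))
    (t : Icc (0 : ℝ) T) :
    outerL d d (x t) (x t) = outerL d d x₀ x₀ + intLyapunov hT M t (pathOuter T d d x x)
      - symL d (intMul hT M t (pathOuter T d d x n))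
      + symL d (outerL d d x₀ (n t)
          + intMul hT M t (pathOuter T d d x (ContinuousMap.const _ (n t))))
      + outerL d d (n t) (n t) := by
  have hc := continuous_clm_apply_projIcc hT (vecDrift M) x
  -- Removing the noise leaves a differentiable path, to which the ordinary product rule applies.
  set y : ℝ → Vec d := fun t =>
    x₀ + ∫ s in (0 : ℝ)..t, vecDrift M (projIcc 0 T hT s) (x (projIcc 0 T hT s)) with hy
  have hyd : ∀ s, HasDerivAt y (vecDrift M (projIcc 0 T hT s) (x (projIcc 0 T hT s))) s := fun s =>
    (hc.integral_hasStrictDerivAt 0 s).hasDerivAt.const_add _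
  have hxy : ∀ s : Icc (0 : ℝ) T, y s = x s - n s :=
    fun s => by rw [hx s, hy, add_sub_right_comm, add_sub_cancel_right]
  have hmul : Continuous fun s => M (projIcc 0 T hT s) *
      pathOuter T d d x n (projIcc 0 T hT s) :=
    continuous_clm_apply_projIcc hT (mulDrift M) (pathOuter T d d x n)
  have hsymc : Continuous fun s => symL d (M (projIcc 0 T hT s) *
      pathOuter T d d x n (projIcc 0 T hT s)) := (symL d).continuous.comp hmul
  have hlyap : Continuous fun s => lyapunovL d (M (projIcc 0 T hT s))
      (pathOuter T d d x x (projIcc 0 T hT s)) :=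
    continuous_clm_apply_projIcc hT (lyapunovDrift M) (pathOuter T d d x x)
  have hsym : symL d (intMul hT M t (pathOuter T d d x n)) = ∫ s in (0 : ℝ)..t,
      symL d (M (projIcc 0 T hT s) * pathOuter T d d x n (projIcc 0 T hT s)) :=
    ((symL d).intervalIntegral_comp_comm (hmul.intervalIntegrable _ _)).symm
  have hyy : outerL d d (y t) (y t) = outerL d d x₀ x₀ + (intLyapunov hT M t (pathOuter T d d x x)
      - symL d (intMul hT M t (pathOuter T d d x n))) := by
    rw [hsym, intLyapunov_apply, ← intervalIntegral.integral_sub (hlyap.intervalIntegrable _ _)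
      (hsymc.intervalIntegrable _ _)]
    have hd : ∀ s ∈ uIcc 0 (t : ℝ), HasDerivAt (fun s => outerL d d (y s) (y s))
        (lyapunovL d (M (projIcc 0 T hT s)) (pathOuter T d d x x (projIcc 0 T hT s))
          - symL d (M (projIcc 0 T hT s) * pathOuter T d d x n (projIcc 0 T hT s))) s := by
      intro s hs
      have halg : ∀ a b c e : Matrix (Fin d) (Fin d) ℝ, a - b + (c - e) = c + a - (e + b) := by
        intros; abel
      rw [uIcc_of_le t.2.1] at hs
      have hs' : s ∈ Icc 0 T := ⟨hs.1, hs.2.trans t.2.2⟩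
      refine ((outerL d d).hasDerivAt_of_bilinear (fun _ => hyd s) (fun _ => hyd s)).congr_deriv ?_
      have e : y s = x (projIcc 0 T hT s) - n (projIcc 0 T hT s) := by
        rw [projIcc_of_mem hT hs']; exact hxy ⟨s, hs'⟩
      rw [e]
      set p := projIcc 0 T hT s
      have e2 : ∀ a b : Vec d, outerL d d a (act (M p) b) = (M p * outerL d d b a)ᵀ := fun a b => by
        rw [← outerL_act_left, transpose_outerL]
      simp only [vecDrift_apply, actL_apply, lyapunovL_apply, symL_apply, pathOuter_apply, e2,
        outerL_act_left, map_sub, sub_apply, Matrix.transpose_mul, transpose_outerL]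
      exact halg _ _ _ _
    have := intervalIntegral.integral_eq_sub_of_hasDerivAt hd
      ((hlyap.sub hsymc).intervalIntegrable _ _)
    rw [this]
    simp [hy]
  have hyn : outerL d d (y t) (n t) = outerL d d x₀ (n t)
      + intMul hT M t (pathOuter T d d x (ContinuousMap.const _ (n t))) := by
    rw [hxy t, map_sub, sub_apply, outerL_solution hT hx (n t) t]
    abel
  -- Expanding `x xᵀ` leaves two drift integrals of opposite sign, one of `x_s n_sᵀ` and one of `x_s
  -- n_tᵀ`; they differ pathwise but will agree in expectation.
  have hxe : x t = y t + n t := by rw [hxy t]; abel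
  have hexp : outerL d d (x t) (x t) = outerL d d (y t) (y t) + symL d (outerL d d (y t) (n t))
      + outerL d d (n t) (n t) := by
    rw [hxe, symL_apply, transpose_outerL]
    simp only [map_add, add_apply]
    abel
  rw [hexp, ← hyn, hyy]
  abel

end Drift

/-! ### The Lyapunov equation for the second moment -/

section LyapunovMoment

lemma integral_add_sub_add_add {Ω E : Type*} [MeasurableSpace Ω] {P : Measure Ω}
    [NormedAddCommGroup E] [NormedSpace ℝ E] {a b c e f : Ω → E} (ha : Integrable a P)
    (hb : Integrable b P) (hc : Integrable c P) (he : Integrable e P) (hf : Integrable f P) :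
    ∫ ω, (a ω + b ω - c ω + e ω + f ω) ∂P
      = ∫ ω, a ω ∂P + ∫ ω, b ω ∂P - ∫ ω, c ω ∂P + ∫ ω, e ω ∂P + ∫ ω, f ω ∂P := by
  rw [integral_add (f := fun ω => a ω + b ω - c ω + e ω) (((ha.add hb).sub hc).add he) hf,
    integral_add (f := fun ω => a ω + b ω - c ω) ((ha.add hb).sub hc) he,
    integral_sub (f := fun ω => a ω + b ω) (ha.add hb) hc, integral_add ha hb]

variable {Ω : Type*} [MeasurableSpace Ω] {P : Measure Ω} {d : ℕ} {hT : 0 ≤ T}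
  {M : C(Icc (0 : ℝ) T, Matrix (Fin d) (Fin d) ℝ)} {X N : Ω → C(Icc (0 : ℝ) T, Vec d)}
  {X₀ : Ω → Vec d}

/-- Solutions are uncorrelated with variables that are uncorrelated with the past input. -/
lemma crossMoment_const_eq_zero (hX : MemLp X 2 P) (hN : MemLp N 2 P) (hX₀ : MemLp X₀ 2 P)
    (hsol : ∀ᵐ ω ∂P, ∀ t : Icc (0 : ℝ) T, X ω t = (X₀ ω + N ω t)
      + ∫ s in (0 : ℝ)..t, vecDrift M (projIcc 0 T hT s) (X ω (projIcc 0 T hT s)))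
    {z : Ω → Vec d} (hz : MemLp z 2 P) (h0 : ∫ ω, outerL d d (X₀ ω) (z ω) ∂P = 0)
    {τ : Icc (0 : ℝ) T} (hNz : ∀ s ≤ τ, ∫ ω, outerL d d (N ω s) (z ω) ∂P = 0) :
    ∀ s ≤ τ, ∫ ω, outerL d d (X ω s) (z ω) ∂P = 0 := by
  have hZ := memLp_const_path (T := T) hz
  have hI := integrable_pathOuter hX hZ
  set D := crossMoment P X fun ω => ContinuousMap.const _ (z ω) with hD
  have hDs : ∀ s, D s = ∫ ω, outerL d d (X ω s) (z ω) ∂P := crossMoment_apply hX hZ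
  intro s hs
  rw [← hDs]
  -- Up to time `τ` the cross moment solves a homogeneous linear Volterra equation, hence vanishes.
  have heq : ∀ s : Icc (0 : ℝ) T, (s : ℝ) ≤ τ → D s = 0 + ∫ r in (0 : ℝ)..s,
      mulDrift M (projIcc 0 T hT r) (D (projIcc 0 T hT r)) := by
    intro s hs
    have h1 : D s = ∫ ω, (outerL d d (X₀ ω) (z ω) + outerL d d (N ω s) (z ω)
        + intMul hT M s (pathOuter T d d (X ω) (ContinuousMap.const _ (z ω)))) ∂P := by
      rw [hDs]
      refine integral_congr_ae ?_
      filter_upwards [hsol] with ω hω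
      exact outerL_solution hT hω (z ω) s
    rw [integral_add (f := fun ω => outerL d d (X₀ ω) (z ω) + outerL d d (N ω s) (z ω))
      ((integrable_outerL hX₀ hz).add (integrable_outerL (memLp_eval hN s) hz))
      ((intMul hT M s).integrable_comp hI), integral_add (integrable_outerL hX₀ hz)
      (integrable_outerL (memLp_eval hN s) hz), h0, hNz s hs, add_zero,
      (intMul hT M s).integral_comp_comm hI] at h1
    exact h1
  have h0' : ∀ s : Icc (0 : ℝ) T, (s : ℝ) ≤ τ →
      (0 : C(Icc (0 : ℝ) T, Matrix (Fin d) (Fin d) ℝ)) s = 0 + ∫ r in (0 : ℝ)..s,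
        mulDrift M (projIcc 0 T hT r)
          ((0 : C(Icc (0 : ℝ) T, Matrix (Fin d) (Fin d) ℝ)) (projIcc 0 T hT r)) := by
    intro s _
    simp
  exact eq_of_volterra hT (h := fun _ => 0) τ.2.2 heq h0' s hs

/-- The second moment of the solution of a linear equation driven by noise with covariance
`E[N_s N_tᵀ] = (s ∧ t) R` solves the Lyapunov equation. -/
lemma isLyapunov_crossMoment (hX : MemLp X 2 P) (hN : MemLp N 2 P) (hX₀ : MemLp X₀ 2 P)
    (hsol : ∀ᵐ ω ∂P, ∀ t : Icc (0 : ℝ) T, X ω t = (X₀ ω + N ω t)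
      + ∫ s in (0 : ℝ)..t, vecDrift M (projIcc 0 T hT s) (X ω (projIcc 0 T hT s)))
    {R S₀ : Matrix (Fin d) (Fin d) ℝ} (h00 : ∫ ω, outerL d d (X₀ ω) (X₀ ω) ∂P = S₀)
    (h0N : ∀ t, ∫ ω, outerL d d (X₀ ω) (N ω t) ∂P = 0)
    (hNN : ∀ s t : Icc (0 : ℝ) T, s ≤ t → ∫ ω, outerL d d (N ω s) (N ω t) ∂P = (s : ℝ) • R) :
    IsLyapunov hT M R S₀ (crossMoment P X X) := by
  intro t
  have hNt := memLp_eval hN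
  have hXt := memLp_eval hX
  have hconst := integrable_pathOuter hX (memLp_const_path (T := T) (hNt t))
  have hXX := integrable_pathOuter hX hX
  have hXN := integrable_pathOuter hX hN
  -- `X_s` is uncorrelated with `N_t - N_s`, because `E[N_r (N_t - N_s)ᵀ] = r R - r R = 0` for `r ≤
  -- s`.
  have hcross : ∀ s ≤ t, ∫ ω, outerL d d (X ω s) (N ω t) ∂P
      = ∫ ω, outerL d d (X ω s) (N ω s) ∂P := by
    intro s hs
    have := crossMoment_const_eq_zero (τ := s) hX hN hX₀ hsol ((hNt t).sub (hNt s)) ?_ ?_ s le_rfl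
    · simp only [Pi.sub_apply, map_sub] at this
      rwa [integral_sub (integrable_outerL (hXt s) (hNt t)) (integrable_outerL (hXt s) (hNt s)),
        sub_eq_zero] at this
    · simp only [Pi.sub_apply, map_sub]
      rw [integral_sub (integrable_outerL hX₀ (hNt t)) (integrable_outerL hX₀ (hNt s)), h0N, h0N,
        sub_zero]
    · intro r hr
      simp only [Pi.sub_apply, map_sub]
      rw [integral_sub (integrable_outerL (hNt r) (hNt t)) (integrable_outerL (hNt r) (hNt s)),
        hNN r t (hr.trans hs), hNN r s hr, sub_self]
  -- With this the two mixed drift terms cancel in expectation, leaving the source `t R` from `E[N_t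
  -- N_tᵀ]`.
  have hint : intMul hT M t (crossMoment P X fun ω => ContinuousMap.const _ (N ω t))
      = intMul hT M t (crossMoment P X N) := by
    rw [intMul_apply, intMul_apply]
    refine intervalIntegral.integral_congr fun r hr => ?_
    rw [uIcc_of_le t.2.1] at hr
    have hr' : r ∈ Icc 0 T := ⟨hr.1, hr.2.trans t.2.2⟩
    rw [projIcc_of_mem hT hr', crossMoment_apply hX (memLp_const_path (hNt t)),
      crossMoment_apply hX hN]
    congr 1
    exact hcross ⟨r, hr'⟩ hr.2
  have hae : crossMoment P X X t = ∫ ω, (outerL d d (X₀ ω) (X₀ ω)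
      + intLyapunov hT M t (pathOuter T d d (X ω) (X ω))
      - symL d (intMul hT M t (pathOuter T d d (X ω) (N ω)))
      + symL d (outerL d d (X₀ ω) (N ω t)
          + intMul hT M t (pathOuter T d d (X ω) (ContinuousMap.const _ (N ω t))))
      + outerL d d (N ω t) (N ω t)) ∂P := by
    rw [crossMoment_apply hX hX]
    refine integral_congr_ae ?_
    filter_upwards [hsol] with ω hω
    exact outerL_solution_self hT hω t
  have i1 := integrable_outerL hX₀ hX₀
  have i2 := (intLyapunov hT M t).integrable_comp hXX
  have i3 := (symL d).integrable_comp ((intMul hT M t).integrable_comp hXN)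
  have i4 := integrable_outerL hX₀ (hNt t)
  have i5 := (intMul hT M t).integrable_comp hconst
  have i45 : Integrable (fun ω => outerL d d (X₀ ω) (N ω t)
      + intMul hT M t (pathOuter T d d (X ω) (ContinuousMap.const _ (N ω t)))) P := i4.add i5
  have i6 := (symL d).integrable_comp i45
  have i7 := integrable_outerL (hNt t) (hNt t)
  have e6 : ∫ ω, symL d (outerL d d (X₀ ω) (N ω t)
      + intMul hT M t (pathOuter T d d (X ω) (ContinuousMap.const _ (N ω t)))) ∂P
      = symL d (intMul hT M t (crossMoment P X N)) := by
    rw [(symL d).integral_comp_comm i45, integral_add i4 i5, h0N, zero_add,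
      (intMul hT M t).integral_comp_comm hconst]
    exact congrArg (symL d) hint
  have e3 : ∫ ω, symL d (intMul hT M t (pathOuter T d d (X ω) (N ω))) ∂P
      = symL d (intMul hT M t (crossMoment P X N)) := by
    rw [(symL d).integral_comp_comm ((intMul hT M t).integrable_comp hXN),
      (intMul hT M t).integral_comp_comm hXN]
    rfl
  have e2 : ∫ ω, intLyapunov hT M t (pathOuter T d d (X ω) (X ω)) ∂P
      = intLyapunov hT M t (crossMoment P X X) :=
    (intLyapunov hT M t).integral_comp_comm hXX
  rw [hae, integral_add_sub_add_add i1 i2 i3 i6 i7, h00, hNN t t le_rfl, e2, e3, e6]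
  change S₀ + intLyapunov hT M t (crossMoment P X X) - _ + _ + _ =
    S₀ + (t : ℝ) • R + intLyapunov hT M t (crossMoment P X X)
  abel

end LyapunovMoment

/-! ### Moments of the noise and of the initial value -/

section Noise

variable {Ω : Type*} {T : ℝ} {n k d : ℕ}

open Classical in
/-- The restriction to `[0, T]` of a real-valued path, if it is continuous, and `0` otherwise. -/
def restrictPath (T : ℝ) (b : ℝ≥0 → ℝ) : C(Icc (0 : ℝ) T, ℝ) :=
  if h : Continuous b then
    ⟨fun t => b (t : ℝ).toNNReal, h.comp (continuous_real_toNNReal.comp continuous_subtype_val)⟩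
  else 0

lemma restrictPath_apply {b : ℝ≥0 → ℝ} (h : Continuous b) (t : Icc (0 : ℝ) T) :
    restrictPath T b t = b (t : ℝ).toNNReal := by
  rw [restrictPath, dif_pos h]
  rfl

/-- The map taking a real-valued path `b` to the path `b σⱼ`, with `σⱼ` the column `j` of `σ`. -/
def colPath (T : ℝ) (σ : Matrix (Fin k) (Fin n) ℝ) (j : Fin n) :
    C(Icc (0 : ℝ) T, ℝ) →L[ℝ] C(Icc (0 : ℝ) T, Vec k) :=
  ContinuousLinearMap.compLeftContinuous ℝ (Icc (0 : ℝ) T)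
    (ContinuousLinearMap.toSpanSingleton ℝ (act σ (EuclideanSpace.single j 1)))

/-- A version on `[0, T]` with continuous paths of the process `σ B`. -/
def noisePath (T : ℝ) (σ : Matrix (Fin k) (Fin n) ℝ) (B : ℝ≥0 → Ω → Vec n) (ω : Ω) :
    C(Icc (0 : ℝ) T, Vec k) :=
  ∑ j, colPath T σ j (restrictPath T fun t => B t ω j)

variable [MeasurableSpace Ω] {P : Measure Ω} {B : ℝ≥0 → Ω → Vec n}
  (σ : Matrix (Fin k) (Fin n) ℝ)

lemma noisePath_ae_eq (hB : IsWiener B P) :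
    ∀ᵐ ω ∂P, ∀ t : Icc (0 : ℝ) T, noisePath T σ B ω t = act σ (B (t : ℝ).toNNReal ω) := by
  filter_upwards [ae_all_iff.2 fun j => (hB.brownian j).cont] with ω hω t
  have h (x : Vec n) : x = ∑ j, x j • EuclideanSpace.single j (1 : ℝ) := by
    ext i
    simp [Finset.sum_apply, Pi.single_apply]
  conv_rhs => rw [h (B (t : ℝ).toNNReal ω)]
  refine Eq.trans ?_ (map_sum (Matrix.toEuclideanLin σ) _ _).symm
  simp only [noisePath, ContinuousMap.coe_sum, Finset.sum_apply, map_smul]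
  refine Finset.sum_congr rfl fun j _ => ?_
  rw [← restrictPath_apply (hω j) t]
  rfl

lemma memLp_wiener_apply (hB : IsWiener B P) (t : ℝ≥0) (j : Fin n) :
    MemLp (fun ω => B t ω j) 2 P :=
  ((IsPreBrownianReal.isGaussianProcess (hB.brownian j).1).hasGaussianLaw_eval t).memLp_two

lemma integral_matrix_apply {f : Ω → Matrix (Fin k) (Fin n) ℝ} (hf : Integrable f P) (i : Fin k)
    (j : Fin n) : (∫ ω, f ω ∂P) i j = ∫ ω, f ω i j ∂P :=
  ((LinearMap.toContinuousLinearMap (Matrix.entryLinearMap ℝ ℝ i j)).integral_comp_comm hf).symm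

lemma memLp_of_hasLaw_multivariateGaussian {S₀ : Matrix (Fin k) (Fin k) ℝ} {ξ₀ : Ω → Vec k}
    (hlaw : HasLaw ξ₀ (multivariateGaussian 0 S₀) P) : MemLp ξ₀ 2 P :=
  hlaw.hasGaussianLaw.memLp_two

lemma memLp_wiener (hB : IsWiener B P) (t : ℝ≥0) : MemLp (B t) 2 P := by
  have h (x : Vec n) : x = ∑ j, x j • EuclideanSpace.single j (1 : ℝ) := by
    ext i
    simp [Finset.sum_apply, Pi.single_apply]
  rw [funext fun ω => h (B t ω)]
  exact memLp_finsetSum _ fun j _ => ContinuousLinearMap.comp_memLp'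
    (ContinuousLinearMap.toSpanSingleton ℝ (EuclideanSpace.single j (1 : ℝ) : Vec n))
    (memLp_wiener_apply hB t j)

lemma memLp_sum {E ι : Type*} [NormedAddCommGroup E] [Fintype ι] {p : ℝ≥0∞} {f : ι → Ω → E}
    (hf : ∀ j, MemLp (f j) p P) : MemLp (fun ω => ∑ j, f j ω) p P :=
  memLp_finsetSum Finset.univ fun j _ => hf j

variable [IsProbabilityMeasure P]

lemma memLp_restrictPath (hT : 0 ≤ T) (hB : IsWiener B P) (j : Fin n) :
    MemLp (fun ω => restrictPath T fun t => B t ω j) 2 P := by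
  refine memLp_two_of_isGaussianProcess hT
    (IsPreBrownianReal.isGaussianProcess (hB.brownian j).1)
    (hB.brownian j).integral_eval (fun t => (t : ℝ).toNNReal) fun t => ?_
  filter_upwards [(hB.brownian j).cont] with ω hω
  exact restrictPath_apply hω t

/-- Writing `σ B` as the sum of the scalar motions times the columns of `σ` reduces this to
one-dimensional paths. -/
lemma memLp_noisePath (hT : 0 ≤ T) (hB : IsWiener B P) : MemLp (noisePath T σ B) 2 P := by
  have hc (j : Fin n) : MemLp (fun ω => colPath T σ j (restrictPath T fun t => B t ω j)) 2 P :=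
    (colPath T σ j).comp_memLp' (memLp_restrictPath hT hB j)
  exact memLp_sum hc

lemma integral_wiener_mul (hB : IsWiener B P) (s t : ℝ≥0) (i j : Fin n) :
    ∫ ω, B s ω i * B t ω j ∂P = if i = j then ((min s t : ℝ≥0) : ℝ) else 0 := by
  split_ifs with h
  · subst h
    rw [← (hB.brownian i).covariance_fun_eval s t, covariance_eq_sub (memLp_wiener_apply hB s i)
      (memLp_wiener_apply hB t i), (hB.brownian i).integral_eval s, zero_mul, sub_zero]
    rfl
  · have := (hB.indep.indepFun h).comp (measurable_pi_apply s) (measurable_pi_apply t)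
    refine (this.integral_fun_mul_eq_mul_integral (memLp_wiener_apply hB s i).1
      (memLp_wiener_apply hB t j).1).trans ?_
    exact mul_eq_zero_of_left ((hB.brownian i).integral_eval s) _

lemma outerL_act_act (σ : Matrix (Fin k) (Fin n) ℝ) (x z : Vec n) :
    outerL k k (act σ x) (act σ z) = σ * outerL n n x z * σᵀ := by
  rw [outerL_act_left, ← transpose_outerL, outerL_act_left, Matrix.transpose_mul,
    transpose_outerL, Matrix.mul_assoc]

lemma integral_outerL_wiener (hB : IsWiener B P) (s t : ℝ≥0) :
    ∫ ω, outerL n n (B s ω) (B t ω) ∂P =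
      ((min s t : ℝ≥0) : ℝ) • (1 : Matrix (Fin n) (Fin n) ℝ) := by
  ext i j
  rw [integral_matrix_apply (integrable_outerL (memLp_wiener hB s) (memLp_wiener hB t))]
  simp only [outerL_apply]
  rw [integral_wiener_mul hB]
  simp [Matrix.one_apply]

lemma integral_outerL_noisePath (hB : IsWiener B P) (s t : Icc (0 : ℝ) T) (hst : s ≤ t) :
    ∫ ω, outerL k k (noisePath T σ B ω s) (noisePath T σ B ω t) ∂P = (s : ℝ) • (σ * σᵀ) := by
  have h : (fun ω => outerL k k (noisePath T σ B ω s) (noisePath T σ B ω t)) =ᵐ[P] fun ω =>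
      σ * outerL n n (B (s : ℝ).toNNReal ω) (B (t : ℝ).toNNReal ω) * σᵀ := by
    filter_upwards [noisePath_ae_eq (T := T) σ hB] with ω hω
    rw [hω, hω, outerL_act_act]
  let L : Matrix (Fin n) (Fin n) ℝ →L[ℝ] Matrix (Fin k) (Fin k) ℝ :=
    LinearMap.toContinuousLinearMap
      (mulRightLinearMap _ ℝ σᵀ ∘ₗ mulLeftLinearMap _ ℝ σ)
  rw [integral_congr_ae h]
  refine (L.integral_comp_comm (integrable_outerL (memLp_wiener hB _) (memLp_wiener hB _))).trans ?_
  rw [integral_outerL_wiener hB, min_eq_left (Real.toNNReal_le_toNNReal hst), map_smul,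
    Real.coe_toNNReal _ s.2.1]
  congr 1
  exact congrArg (· * σᵀ) (Matrix.mul_one σ)

lemma integral_outerL_noisePath_of_indepFun {ξ₀ : Ω → Vec k} (hB : IsWiener B P)
    (hT : 0 ≤ T) (hξ₀ : MemLp ξ₀ 2 P) (hind : IndepFun ξ₀ (fun ω t => B t ω) P)
    (t : Icc (0 : ℝ) T) :
    ∫ ω, outerL k k (ξ₀ ω) (noisePath T σ B ω t) ∂P = 0 := by
  have hN := memLp_eval (memLp_noisePath σ hT hB) t
  set τ := (t : ℝ).toNNReal
  have h0 : ∫ ω, outerL k n (ξ₀ ω) (B τ ω) ∂P = 0 := by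
    ext i j
    rw [integral_matrix_apply (integrable_outerL hξ₀ (memLp_wiener hB τ))]
    simp only [outerL_apply]
    have := hind.comp (φ := fun x : Vec k => x i) (ψ := fun b : ℝ≥0 → Vec n => b τ j)
      (by fun_prop) (by fun_prop)
    refine (this.integral_fun_mul_eq_mul_integral
      (ContinuousLinearMap.comp_memLp' (EuclideanSpace.proj i : Vec k →L[ℝ] ℝ) hξ₀).1
      (memLp_wiener_apply hB τ j).1).trans ?_
    exact mul_eq_zero_of_right _ ((hB.brownian j).integral_eval τ)
  have h : (fun ω => outerL k k (ξ₀ ω) (noisePath T σ B ω t)) =ᵐ[P] fun ω =>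
      outerL k n (ξ₀ ω) (B τ ω) * σᵀ := by
    filter_upwards [noisePath_ae_eq (T := T) σ hB] with ω hω
    rw [hω, ← transpose_outerL, outerL_act_left, Matrix.transpose_mul, transpose_outerL]
  rw [integral_congr_ae h]
  let L : Matrix (Fin k) (Fin n) ℝ →L[ℝ] Matrix (Fin k) (Fin k) ℝ :=
    LinearMap.toContinuousLinearMap (mulRightLinearMap _ ℝ σᵀ)
  refine (L.integral_comp_comm (integrable_outerL hξ₀ (memLp_wiener hB _))).trans ?_
  rw [h0, map_zero]

lemma integral_outerL_self_of_hasLaw {S₀ : Matrix (Fin k) (Fin k) ℝ} (hS₀ : S₀.PosSemidef)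
    {ξ₀ : Ω → Vec k} (hlaw : HasLaw ξ₀ (multivariateGaussian 0 S₀) P) :
    ∫ ω, outerL k k (ξ₀ ω) (ξ₀ ω) ∂P = S₀ := by
  have hξ := memLp_of_hasLaw_multivariateGaussian hlaw
  have hi (i : Fin k) : MemLp (fun ω => ξ₀ ω i) 2 P :=
    ContinuousLinearMap.comp_memLp' (EuclideanSpace.proj i : Vec k →L[ℝ] ℝ) hξ
  have hmean : ∫ ω, ξ₀ ω ∂P = 0 :=
    (hlaw.integral_comp (f := id) (by fun_prop)).trans integral_id_multivariateGaussian
  have hmi (i : Fin k) : ∫ ω, ξ₀ ω i ∂P = 0 := by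
    refine ((EuclideanSpace.proj i : Vec k →L[ℝ] ℝ).integral_comp_comm
      (hξ.integrable (by norm_num))).trans ?_
    rw [hmean, map_zero]
  ext i j
  rw [integral_matrix_apply (integrable_outerL hξ hξ)]
  have h := hlaw.covariance_fun_comp (f := fun x => x i) (g := fun x => x j) (by fun_prop)
    (by fun_prop)
  rw [covariance_eval_multivariateGaussian hS₀, covariance_eq_sub (hi i) (hi j), hmi, zero_mul,
    sub_zero] at h
  exact h

end Noise

/-! ### Well-posedness of the linear equation -/

section RandomPath

variable {Ω : Type*} [MeasurableSpace Ω] {P : Measure Ω} {T : ℝ} {d m n : ℕ}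

lemma iSup_enorm_apply_sq {F : Type*} [NormedAddCommGroup F] (hT : 0 ≤ T)
    (f : C(Icc (0 : ℝ) T, F)) :
    ⨆ s : {s : Icc (0 : ℝ) T // (s : ℝ) ≤ T}, ‖f s.1‖ₑ ^ 2 = ‖f‖ₑ ^ 2 := by
  refine le_antisymm (iSup_le fun s => ?_) ?_
  · gcongr
    exact enorm_le_iff_norm_le.2 (f.norm_coe_le_norm s.1)
  · have : Nonempty (Icc (0 : ℝ) T) := ⟨⟨0, left_mem_Icc.2 hT⟩⟩
    obtain ⟨x, -, hx⟩ := isCompact_univ.exists_isMaxOn (univ_nonempty (α := Icc (0 : ℝ) T))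
      (f.continuous.norm.continuousOn)
    refine le_trans ?_ (le_iSup (fun s : {s : Icc (0 : ℝ) T // (s : ℝ) ≤ T} => ‖f s.1‖ₑ ^ 2)
      ⟨x, x.2.2⟩)
    gcongr
    exact enorm_le_iff_norm_le.2
      ((ContinuousMap.norm_le _ (norm_nonneg _)).2 fun y => hx (mem_univ y))

/-- Identifies `𝒳` with square integrable random elements of `C([0, T], ℝᵈ)`: measurability at each
time lifts to the path, and the supremum is its norm. -/
lemma inX_iff_memLp (hT : 0 ≤ T) {X : RandPath Ω d T} : InX P X ↔ MemLp X 2 P := by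
  have h : L2 P T X (fun _ => 0) < ∞ ↔ eLpNorm X 2 P < ∞ := by
    rw [eLpNorm_lt_top_iff_lintegral_rpow_enorm_lt_top (by simp) (by simp), L2]
    simp only [ContinuousMap.zero_apply, sub_zero, iSup_enorm_apply_sq hT]
    rw [ENNReal.rpow_lt_top_iff_of_pos (by positivity)]
    simp
  constructor
  · intro hX
    exact ⟨aestronglyMeasurable_path hT fun s => (hX.aemeasurable s).aestronglyMeasurable,
      h.1 hX.finite⟩
  · intro hX
    exact ⟨fun t => (memLp_eval hX t).1.aemeasurable, h.2 hX.2⟩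

lemma memLp_add {E : Type*} [NormedAddCommGroup E] {p : ℝ≥0∞} {f g : Ω → E} (hf : MemLp f p P)
    (hg : MemLp g p P) : MemLp (fun ω => f ω + g ω) p P :=
  hf.add hg

lemma secondMoment_eq_crossMoment {X : RandPath Ω d T} (hX : MemLp X 2 P) (t : Icc (0 : ℝ) T) :
    secondMoment P X t = crossMoment P X X t := by
  ext i j
  rw [crossMoment_apply hX hX,
    integral_matrix_apply (integrable_outerL (memLp_eval hX t) (memLp_eval hX t))]
  rfl

variable [IsProbabilityMeasure P] {A : Matrix (Fin d) (Fin d) ℝ} {H : Matrix (Fin m) (Fin d) ℝ}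
  {σ : Matrix (Fin d) (Fin n) ℝ} {ξ₀ : Ω → Vec d} {B : ℝ≥0 → Ω → Vec n} {hT : 0 ≤ T}
  {Q U : C(Icc (0 : ℝ) T, Matrix (Fin d) (Fin d) ℝ)} {ξ η : RandPath Ω d T}

omit [IsProbabilityMeasure P] in
lemma solves_iff (hB : IsWiener B P) : Solves P hT A H σ ξ₀ B Q ξ ↔
    ∀ᵐ ω ∂P, ∀ t : Icc (0 : ℝ) T, ξ ω t = (ξ₀ ω + noisePath T σ B ω t) + ∫ s in (0 : ℝ)..t,
      vecDrift (ricc A H Q) (projIcc 0 T hT s) (ξ ω (projIcc 0 T hT s)) := by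
  refine eventually_congr ?_
  filter_upwards [noisePath_ae_eq (T := T) σ hB] with ω hω
  refine forall_congr' fun t => ?_
  rw [hω t, add_right_comm]
  rfl

omit [IsProbabilityMeasure P] in
-- Additive noise makes the SDE a pathwise equation, so its solution is explicit up to a null set.
lemma solves_iff_eq_resolvent (hB : IsWiener B P) : Solves P hT A H σ ξ₀ B Q ξ ↔
    ∀ᵐ ω ∂P, ξ ω = resolvent hT (vecDrift (ricc A H Q))
      (ContinuousMap.const _ (ξ₀ ω) + noisePath T σ B ω) := by
  rw [solves_iff hB]
  refine eventually_congr (ae_of_all _ fun ω => ?_)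
  rw [eq_resolvent_iff]
  rfl

omit [IsProbabilityMeasure P] in
-- Causality: the solutions for `g` and for `g` stopped at `t` satisfy the same equation up to time
-- `t`. Adaptedness rests on this.
lemma resolvent_apply_eq_stopAt (a : C(Icc (0 : ℝ) T, Vec d →L[ℝ] Vec d))
    (g : C(Icc (0 : ℝ) T, Vec d)) (t : Icc (0 : ℝ) T) :
    resolvent hT a g t = resolvent hT a (stopAt t g) t := by
  have h1 := (eq_resolvent_iff hT a _ g).1 rfl
  have h2 := (eq_resolvent_iff hT a _ (stopAt t g)).1 rfl
  refine eq_of_volterra hT (a := a) (h := g) t.2.2 (fun s _ => h1 s) (fun s hs => ?_) t le_rfl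
  refine (h2 s).trans ?_
  rw [stopAt_apply, min_eq_left (show s ≤ t from hs)]

omit [IsProbabilityMeasure P] in
lemma isStrong_resolvent (hB : IsWiener B P) (a : C(Icc (0 : ℝ) T, Vec d →L[ℝ] Vec d)) :
    IsStrong P ξ₀ B fun ω => resolvent hT a
      (ContinuousMap.const _ (ξ₀ ω) + noisePath T σ B ω) := by
  intro t
  rw [funext fun ω => resolvent_apply_eq_stopAt a
    (ContinuousMap.const _ (ξ₀ ω) + noisePath T σ B ω) t]
  have hc : Continuous fun g : C(Icc (0 : ℝ) T, Vec d) => resolvent hT a g t :=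
    (continuous_eval_const t).comp (resolvent hT a).continuous
  refine hc.comp_aestronglyMeasurable (aestronglyMeasurable_stopAt
    (X := fun ω => ContinuousMap.const _ (ξ₀ ω) + noisePath T σ B ω) fun s hs => ?_)
  have hm : Measurable[inputSigma ξ₀ B (t : ℝ).toNNReal]
      fun ω => ξ₀ ω + act σ (B (s : ℝ).toNNReal ω) := by
    have h1 : Measurable[inputSigma ξ₀ B (t : ℝ).toNNReal] ξ₀ :=
      (comap_measurable ξ₀).mono le_sup_left le_rfl
    have h2 : Measurable[inputSigma ξ₀ B (t : ℝ).toNNReal] (B (s : ℝ).toNNReal) :=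
      (comap_measurable (B (s : ℝ).toNNReal)).mono
        (le_sup_of_le_right (le_iSup (fun r : Iic (t : ℝ).toNNReal =>
          MeasurableSpace.comap (B r) inferInstance)
          ⟨(s : ℝ).toNNReal, Real.toNNReal_le_toNNReal hs⟩)) le_rfl
    exact h1.add ((actL d n σ).continuous.measurable.comp h2)
  refine ⟨_, hm.stronglyMeasurable, ?_⟩
  filter_upwards [noisePath_ae_eq (T := T) σ hB] with ω hω
  rw [ContinuousMap.add_apply, hω]
  rfl

lemma memLp_resolvent (hB : IsWiener B P) (hξ₀ : MemLp ξ₀ 2 P)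
    (a : C(Icc (0 : ℝ) T, Vec d →L[ℝ] Vec d)) :
    MemLp (fun ω => resolvent hT a (ContinuousMap.const _ (ξ₀ ω) + noisePath T σ B ω)) 2 P :=
  (resolvent hT a).comp_memLp' (memLp_add (memLp_const_path hξ₀) (memLp_noisePath σ hT hB))

lemma hasUniqueStrongSolution_solves (hB : IsWiener B P) (hξ₀ : MemLp ξ₀ 2 P) :
    HasUniqueStrongSolution P ξ₀ B (Solves P hT A H σ ξ₀ B Q) := by
  refine ⟨_, (inX_iff_memLp hT).2 (memLp_resolvent hB hξ₀ (vecDrift (ricc A H Q))),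
    isStrong_resolvent (σ := σ) hB _, (solves_iff_eq_resolvent hB).2 (ae_of_all _ fun _ => rfl),
    fun η _ hη => (solves_iff_eq_resolvent hB).1 hη⟩

/-- Besides square integrability, only second-order data of the input enter: `E[ξ₀ ξ₀ᵀ] = S₀`, `E[ξ₀
N_tᵀ] = 0`, and `E[N_s N_tᵀ] = s Σ_B` for `s ≤ t`. -/
lemma isLyapunov_of_solves (hB : IsWiener B P) {S₀ : Matrix (Fin d) (Fin d) ℝ}
    (hS₀ : S₀.PosSemidef) (hlaw : HasLaw ξ₀ (multivariateGaussian 0 S₀) P)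
    (hind : IndepFun ξ₀ (fun ω t => B t ω) P) (hξ : MemLp ξ 2 P)
    (hsol : Solves P hT A H σ ξ₀ B Q ξ) :
    IsLyapunov hT (ricc A H Q) (σ * σᵀ) S₀ (crossMoment P ξ ξ) :=
  isLyapunov_crossMoment hξ (memLp_noisePath σ hT hB) (memLp_of_hasLaw_multivariateGaussian hlaw)
    ((solves_iff hB).1 hsol) (integral_outerL_self_of_hasLaw hS₀ hlaw)
    (integral_outerL_noisePath_of_indepFun σ hB hT (memLp_of_hasLaw_multivariateGaussian hlaw) hind)
    (integral_outerL_noisePath σ hB)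

end RandomPath

/-! ### Weighted integrals and traces -/

section Weighted

variable {T t : ℝ} {l : ℝ → ℝ}

/-- The weighted Cauchy–Schwarz inequality. -/
lemma sq_integral_mul_le {f : ℝ → ℝ} (ht : 0 ≤ t) (hl : IntervalIntegrable l volume 0 t)
    (hl0 : ∀ r, 0 ≤ l r) (hf : Continuous f) :
    (∫ r in (0 : ℝ)..t, l r * f r) ^ 2
      ≤ (∫ r in (0 : ℝ)..t, l r) * ∫ r in (0 : ℝ)..t, l r * f r ^ 2 := by
  have h1 : IntervalIntegrable (fun r => l r * f r) volume 0 t :=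
    hl.mul_continuousOn hf.continuousOn
  have h2 : IntervalIntegrable (fun r => l r * f r ^ 2) volume 0 t :=
    hl.mul_continuousOn (hf.pow 2).continuousOn
  -- The quadratic polynomial `x ↦ ∫ l (x + f)²` is nonnegative, so its discriminant is not
  -- positive; this also covers `∫ l = 0`.
  have h := discrim_le_zero (a := ∫ r in (0 : ℝ)..t, l r) (b := 2 * ∫ r in (0 : ℝ)..t, l r * f r)
    (c := ∫ r in (0 : ℝ)..t, l r * f r ^ 2) fun x => ?_
  · rw [discrim] at h
    linarith
  · have h3 : 0 ≤ ∫ r in (0 : ℝ)..t, l r * (x + f r) ^ 2 :=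
      intervalIntegral.integral_nonneg ht fun r _ => mul_nonneg (hl0 r) (sq_nonneg _)
    have h4 : ∀ r, l r * (x + f r) ^ 2 = x * x * l r + 2 * x * (l r * f r) + l r * f r ^ 2 :=
      fun r => by ring
    simp only [h4] at h3
    rw [intervalIntegral.integral_add ((hl.const_mul _).add (h1.const_mul _)) h2,
      intervalIntegral.integral_add (hl.const_mul _) (h1.const_mul _),
      intervalIntegral.integral_const_mul, intervalIntegral.integral_const_mul] at h3
    linarith

/-- The functional `z ↦ ∫₀ᵗ l_r z_r dr`. -/
def weightL (hT : 0 ≤ T) (ht : 0 ≤ t) (hl : IntervalIntegrable l volume 0 t) :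
    C(Icc (0 : ℝ) T, ℝ) →L[ℝ] ℝ :=
  LinearMap.mkContinuous
    { toFun := fun z => ∫ r in (0 : ℝ)..t, l r * z (projIcc 0 T hT r)
      map_add' := fun z w => by
        simp only [ContinuousMap.add_apply, mul_add]
        exact intervalIntegral.integral_add
          (hl.mul_continuousOn (continuous_comp_projIcc hT z).continuousOn)
          (hl.mul_continuousOn (continuous_comp_projIcc hT w).continuousOn)
      map_smul' := fun c z => by
        simp only [ContinuousMap.smul_apply, smul_eq_mul, RingHom.id_apply, mul_left_comm _ c]
        exact intervalIntegral.integral_const_mul _ _ }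
    (∫ r in (0 : ℝ)..t, ‖l r‖) fun z => by
      refine (intervalIntegral.norm_integral_le_integral_norm ht).trans ?_
      rw [← intervalIntegral.integral_mul_const]
      refine intervalIntegral.integral_mono_on ht
        (hl.mul_continuousOn (continuous_comp_projIcc hT z).continuousOn).norm
        (hl.norm.mul_const _) fun r _ => ?_
      rw [norm_mul]
      gcongr
      exact z.norm_coe_le_norm _

lemma weightL_apply (hT : 0 ≤ T) (ht : 0 ≤ t) (hl : IntervalIntegrable l volume 0 t)
    (z : C(Icc (0 : ℝ) T, ℝ)) :
    weightL hT ht hl z = ∫ r in (0 : ℝ)..t, l r * z (projIcc 0 T hT r) := rfl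

/-- The map taking a matrix path to the path of its traces. -/
def tracePath (T : ℝ) (d : ℕ) : C(Icc (0 : ℝ) T, Matrix (Fin d) (Fin d) ℝ) →L[ℝ]
    C(Icc (0 : ℝ) T, ℝ) :=
  ContinuousLinearMap.compLeftContinuous ℝ (Icc (0 : ℝ) T)
    (LinearMap.toContinuousLinearMap (Matrix.traceLinearMap (Fin d) ℝ ℝ))

lemma tracePath_apply {d : ℕ} (Z : C(Icc (0 : ℝ) T, Matrix (Fin d) (Fin d) ℝ))
    (s : Icc (0 : ℝ) T) : tracePath T d Z s = (Z s).trace := rfl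

lemma trace_outerL_self {d : ℕ} (x : Vec d) : (outerL d d x x).trace = ‖x‖ ^ 2 := by
  rw [EuclideanSpace.real_norm_sq_eq]
  exact Finset.sum_congr rfl fun i _ => (sq _).symm

/-- Each diagonal entry is at most the spectral norm; this is the origin of the factor `d` in `C₁`.
-/
lemma trace_le_mul_norm {d : ℕ} (Z : Matrix (Fin d) (Fin d) ℝ) : Z.trace ≤ d * ‖Z‖ := by
  have h (i : Fin d) : Z i i ≤ ‖Z‖ := by
    have h1 : Z i i = (act Z (EuclideanSpace.single i 1)) i := by simp
    rw [h1]
    refine (le_abs_self _).trans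
      ((PiLp.norm_apply_le (act Z (EuclideanSpace.single i 1)) i).trans ?_)
    refine ((actL d d Z).le_opNorm (EuclideanSpace.single i 1)).trans ?_
    simp [norm_actL]
  refine (Finset.sum_le_sum fun i _ => h i).trans ?_
  simp

end Weighted

/-! ### Comparison of solutions for two covariance paths -/

section Comparison

variable {Ω : Type*} [MeasurableSpace Ω] {P : Measure Ω} {T t : ℝ} {d m n : ℕ}
  {A : Matrix (Fin d) (Fin d) ℝ} {H : Matrix (Fin m) (Fin d) ℝ}
  {σ : Matrix (Fin d) (Fin n) ℝ} {ξ₀ : Ω → Vec d} {B : ℝ≥0 → Ω → Vec n} {hT : 0 ≤ T}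
  {Q U : CovPath d T} {ξ η : RandPath Ω d T}

/-- Pathwise stability, then Cauchy–Schwarz with weight `l_{2,r}(Q, U)`. The bound does not depend
on `s` and is linear in `η ηᵀ`, so supremum and expectation can both be taken. -/
lemma norm_sub_sq_le_of_solves (hB : IsWiener B P) (hξ : Solves P hT A H σ ξ₀ B Q.1 ξ)
    (hη : Solves P hT A H σ ξ₀ B U.1 η) (ht : t ∈ Icc 0 T) :
    ∀ᵐ ω ∂P, ∀ s : Icc (0 : ℝ) T, (s : ℝ) ≤ t → ‖ξ ω s - η ω s‖ ^ 2 ≤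
      (‖Hᵀ * H‖ / 2 * Real.exp (kappa A H t Q * t)) ^ 2 * (∫ r in (0 : ℝ)..t, l2 r Q.1 U.1) *
        weightL hT ht.1 (intervalIntegrable_l2 Q.1 U.1 0 t)
          (tracePath T d (pathOuter T d d (η ω) (η ω))) := by
  filter_upwards [(solves_iff hB).1 hξ, (solves_iff hB).1 hη] with ω hξω hηω s hs
  have hl := intervalIntegrable_l2 Q.1 U.1 0 t
  have hηc : Continuous fun r => ‖η ω (projIcc 0 T hT r)‖ := (continuous_comp_projIcc hT (η ω)).norm
  have h1 := norm_sub_le_of_volterra hT (kappa_nonneg A H Q t) (a := vecDrift (ricc A H Q.1))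
    (b := vecDrift (ricc A H U.1)) (h := fun s => ξ₀ ω + noisePath T σ B ω s)
    (norm_ricc_le_kappa A H Q) (fun s _ => hξω s) (fun s _ => hηω s) ht.2 s hs
  have h2 : ∫ r in (0 : ℝ)..t, ‖(vecDrift (ricc A H Q.1) - vecDrift (ricc A H U.1))
      (projIcc 0 T hT r) (η ω (projIcc 0 T hT r))‖
        ≤ ‖Hᵀ * H‖ / 2 * ∫ r in (0 : ℝ)..t, l2 r Q.1 U.1 * ‖η ω (projIcc 0 T hT r)‖ := by
    rw [← intervalIntegral.integral_const_mul]
    refine intervalIntegral.integral_mono_on ht.1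
      ((continuous_clm_apply_projIcc hT _ (η ω)).norm.intervalIntegrable _ _)
      ((hl.mul_continuousOn hηc.continuousOn).const_mul _) fun r hr => ?_
    have hr' : r ∈ Icc 0 T := ⟨hr.1, hr.2.trans ht.2⟩
    rw [projIcc_of_mem hT hr', ← mul_assoc]
    refine ((vecDrift (ricc A H Q.1) - vecDrift (ricc A H U.1)) ⟨r, hr'⟩).le_of_opNorm_le ?_ _
    have h3 : ‖actL d d (ricc A H Q.1 ⟨r, hr'⟩ - ricc A H U.1 ⟨r, hr'⟩)‖
        ≤ ‖Hᵀ * H‖ / 2 * l2 r Q.1 U.1 := by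
      rw [norm_actL]
      refine (norm_sqrtRicc_sub_le A H (Q.1 ⟨r, hr'⟩) (U.1 ⟨r, hr'⟩)).trans ?_
      gcongr
      exact norm_sub_le_l2 Q.1 U.1 ⟨r, hr'⟩ le_rfl
    rwa [map_sub] at h3
  have h4 := sq_integral_mul_le ht.1 hl (fun r => l2_nonneg Q.1 U.1 r) hηc
  have h5 : weightL hT ht.1 hl (tracePath T d (pathOuter T d d (η ω) (η ω)))
      = ∫ r in (0 : ℝ)..t, l2 r Q.1 U.1 * ‖η ω (projIcc 0 T hT r)‖ ^ 2 := by
    simp only [weightL_apply, tracePath_apply, pathOuter_apply, trace_outerL_self]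
  rw [h5]
  calc ‖ξ ω s - η ω s‖ ^ 2
      ≤ (Real.exp (kappa A H t Q * t) * (‖Hᵀ * H‖ / 2 *
          ∫ r in (0 : ℝ)..t, l2 r Q.1 U.1 * ‖η ω (projIcc 0 T hT r)‖)) ^ 2 := by
        refine pow_le_pow_left₀ (norm_nonneg _) (h1.trans ?_) 2
        exact mul_le_mul_of_nonneg_left h2 (Real.exp_pos _).le
    _ = (‖Hᵀ * H‖ / 2 * Real.exp (kappa A H t Q * t)) ^ 2 *
          (∫ r in (0 : ℝ)..t, l2 r Q.1 U.1 * ‖η ω (projIcc 0 T hT r)‖) ^ 2 := by ring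
    _ ≤ _ := by
        rw [mul_assoc (_ ^ 2)]
        exact mul_le_mul_of_nonneg_left h4 (sq_nonneg _)

lemma weightL_tracePath_le (W : C(Icc (0 : ℝ) T, Matrix (Fin d) (Fin d) ℝ)) (ht : t ∈ Icc 0 T) :
    weightL hT ht.1 (intervalIntegrable_l2 Q.1 U.1 0 t) (tracePath T d W)
      ≤ d * l2 t W 0 * ∫ r in (0 : ℝ)..t, l2 r Q.1 U.1 := by
  have hl := intervalIntegrable_l2 Q.1 U.1 0 t
  rw [weightL_apply, ← intervalIntegral.integral_const_mul]
  refine intervalIntegral.integral_mono_on ht.1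
    (hl.mul_continuousOn (continuous_comp_projIcc hT (tracePath T d W)).continuousOn)
    (hl.const_mul _) fun r hr => ?_
  have hr' : r ∈ Icc 0 T := ⟨hr.1, hr.2.trans ht.2⟩
  rw [projIcc_of_mem hT hr', mul_comm, tracePath_apply]
  refine mul_le_mul_of_nonneg_right ((trace_le_mul_norm _).trans ?_) (l2_nonneg Q.1 U.1 r)
  gcongr
  exact norm_le_l2_zero W ⟨r, hr'⟩ hr.2

/-- Expectation passes through the linear functional of `η ηᵀ` and yields its value at the second
moment path, at most `d l_{2,t}(F(U), 0)` times `∫ l_{2,r}(Q, U) dr`. With the prefactor, this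
completes the square of the claimed bound. -/
lemma L2_le_of_solves (hB : IsWiener B P) (hη2 : MemLp η 2 P)
    (hξ : Solves P hT A H σ ξ₀ B Q.1 ξ) (hη : Solves P hT A H σ ξ₀ B U.1 η) (ht : t ∈ Icc 0 T) :
    L2 P t ξ η ≤ ENNReal.ofReal (‖Hᵀ * H‖ / 2 * Real.exp (kappa A H t Q * t)
      * Real.sqrt (d * l2 t (crossMoment P η η) 0) * ∫ s in (0 : ℝ)..t, l2 s Q.1 U.1) := by
  set c := ‖Hᵀ * H‖ / 2 * Real.exp (kappa A H t Q * t)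
  set w := d * l2 t (crossMoment P η η) 0
  set Λ := ∫ s in (0 : ℝ)..t, l2 s Q.1 U.1
  have hc : 0 ≤ c := by positivity
  have hw0 : 0 ≤ w := mul_nonneg (Nat.cast_nonneg _) (l2_nonneg _ _ _)
  have hΛ : 0 ≤ Λ := integral_l2_nonneg Q.1 U.1 ht.1
  set Ψ : C(Icc (0 : ℝ) T, Matrix (Fin d) (Fin d) ℝ) →L[ℝ] ℝ :=
    weightL hT ht.1 (intervalIntegrable_l2 Q.1 U.1 0 t) ∘L tracePath T d
  have hint := integrable_pathOuter hη2 hη2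
  have hΨ0 (ω : Ω) : 0 ≤ Ψ (pathOuter T d d (η ω) (η ω)) := by
    refine intervalIntegral.integral_nonneg ht.1 fun r _ => mul_nonneg (l2_nonneg Q.1 U.1 r) ?_
    have h : tracePath T d (pathOuter T d d (η ω) (η ω)) (projIcc 0 T hT r)
        = ‖η ω (projIcc 0 T hT r)‖ ^ 2 := by
      rw [tracePath_apply, pathOuter_apply, trace_outerL_self]
    exact h.symm ▸ sq_nonneg _
  have key : ∫⁻ ω, ⨆ s : {s : Icc (0 : ℝ) T // (s : ℝ) ≤ t}, ‖ξ ω s.1 - η ω s.1‖ₑ ^ 2 ∂P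
      ≤ ENNReal.ofReal ((c * Real.sqrt w * Λ) ^ 2) := by
    calc _ ≤ ∫⁻ ω, ENNReal.ofReal (c ^ 2 * Λ * Ψ (pathOuter T d d (η ω) (η ω))) ∂P := by
          -- Monotonicity of the lower integral requires no measurability of the uncountable
          -- supremum.
          refine lintegral_mono_ae ?_
          filter_upwards [norm_sub_sq_le_of_solves hB hξ hη ht] with ω hω
          refine iSup_le fun s => ?_
          rw [← ofReal_norm, ← ENNReal.ofReal_pow (norm_nonneg _)]
          exact ENNReal.ofReal_le_ofReal (hω s.1 s.2)
      _ = ENNReal.ofReal (c ^ 2 * Λ * Ψ (crossMoment P η η)) := by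
          rw [← ofReal_integral_eq_lintegral_ofReal ((Ψ.integrable_comp hint).const_mul _)
            (ae_of_all _ fun ω => by have := hΨ0 ω; positivity), integral_const_mul,
            Ψ.integral_comp_comm hint]
          rfl
      _ ≤ _ := by
          refine ENNReal.ofReal_le_ofReal ?_
          have h := weightL_tracePath_le (hT := hT) (Q := Q) (U := U) (crossMoment P η η) ht
          calc c ^ 2 * Λ * Ψ (crossMoment P η η) ≤ c ^ 2 * Λ * (w * Λ) := by
                gcongr
                exact h
            _ = _ := by linear_combination (-(c ^ 2 * Λ ^ 2)) * Real.sq_sqrt hw0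
  rw [L2, one_div, ENNReal.rpow_inv_le_iff (by norm_num)]
  refine key.trans (le_of_eq ?_)
  rw [ENNReal.ofReal_pow (by positivity)]
  norm_cast

end Comparison

/-! ### The McKean–Vlasov equation -/

section McKeanVlasov

variable {T : ℝ} {hT : 0 ≤ T} {d m : ℕ} {A : Matrix (Fin d) (Fin d) ℝ}
  {H : Matrix (Fin m) (Fin d) ℝ}

/-- Solutions of the matrix Riccati equation are unique. -/
lemma eq_of_isLyapunov_ricc_self {R S₀ : Matrix (Fin d) (Fin d) ℝ}
    {V W : C(Icc (0 : ℝ) T, Matrix (Fin d) (Fin d) ℝ)}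
    (hV : IsLyapunov hT (ricc A H V) R S₀ V) (hW : IsLyapunov hT (ricc A H W) R S₀ W) : V = W := by
  set κ := ‖ricc A H V‖
  have hκ : 0 ≤ κ := norm_nonneg _
  -- The constant of the Lipschitz estimate on `[0, T]` when the coefficient paths are `V` and `W`
  -- themselves; Grönwall with zero data then forces `V = W`.
  set K := Real.exp (2 * κ * T) * (‖Hᵀ * H‖ * ‖W‖)
  have hK : 0 ≤ K := by positivity
  have hu : Continuous fun r => ‖V (projIcc 0 T hT r) - W (projIcc 0 T hT r)‖ :=
    ((continuous_comp_projIcc hT V).sub (continuous_comp_projIcc hT W)).norm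
  have h := le_gronwallBound_of_le_integral (a := 0) (ε := 0) (t := T) hu hK fun s hs => ?_
  · ext1 s
    have h1 := h s s.2
    rw [projIcc_val, gronwallBound_ε0, zero_mul] at h1
    exact sub_eq_zero.1 (norm_le_zero_iff.1 h1)
  · rw [projIcc_of_mem hT hs]
    refine (hV.norm_sub_le hW hκ hs.2 (fun r _ => (ricc A H V).norm_coe_le_norm r)
      ⟨s, hs⟩ le_rfl).trans ?_
    simp only [zero_add, add_zero]
    rw [intervalIntegral.integral_const_mul, mul_assoc (Real.exp _)]
    have h0 : 0 ≤ ∫ r in (0 : ℝ)..s, ‖V (projIcc 0 T hT r) - W (projIcc 0 T hT r)‖ :=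
      intervalIntegral.integral_nonneg hs.1 fun _ _ => norm_nonneg _
    refine mul_le_mul ?_ ?_
      (intervalIntegral.integral_nonneg hs.1 fun _ _ => norm_nonneg _) (Real.exp_pos _).le
    · gcongr
      exact hs.2
    · rw [← intervalIntegral.integral_const_mul]
      refine intervalIntegral.integral_mono_on hs.1 (Continuous.intervalIntegrable ?_ _ _)
        ((hu.intervalIntegrable _ _).const_mul _) fun r _ => ?_
      · exact (((lyapunovL d).continuous.comp ((continuous_comp_projIcc hT (ricc A H V)).sub
          (continuous_comp_projIcc hT (ricc A H W)))).clm_apply (continuous_comp_projIcc hT W)).norm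
      · refine (norm_lyapunovL_apply_le _ _).trans ?_
        have h1 := norm_sqrtRicc_sub_le A H (V (projIcc 0 T hT r)) (W (projIcc 0 T hT r))
        have h2 := W.norm_coe_le_norm (projIcc 0 T hT r)
        calc _ ≤ 2 * (‖Hᵀ * H‖ / 2 * ‖V (projIcc 0 T hT r) - W (projIcc 0 T hT r)‖) * ‖W‖ := by
              gcongr
              exact h1
          _ = _ := by ring

variable {Ω : Type*} [MeasurableSpace Ω] {P : Measure Ω} [IsProbabilityMeasure P] {n : ℕ}
  {σ : Matrix (Fin d) (Fin n) ℝ} {ξ₀ : Ω → Vec d} {B : ℝ≥0 → Ω → Vec n}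

/-- For the Riccati solution `V`, the linear equation with `Q = V` has second moment `V`, so its
solution solves the nonlinear equation. Conversely, the second moment of any solution in `𝒳`
satisfies the same Riccati equation, hence is `V`, and linear uniqueness applies. -/
lemma hasUniqueStrongSolution_solvesMcKeanVlasov (hB : IsWiener B P)
    {S₀ : Matrix (Fin d) (Fin d) ℝ} (hS₀ : S₀.PosDef)
    (hlaw : HasLaw ξ₀ (multivariateGaussian 0 S₀) P) (hind : IndepFun ξ₀ (fun ω t => B t ω) P) :
    HasUniqueStrongSolution P ξ₀ B (SolvesMcKeanVlasov P hT A H σ ξ₀ B) := by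
  obtain ⟨V, -, hV⟩ := exists_isLyapunov_ricc_self hT A H
    (Matrix.posSemidef_self_mul_conjTranspose σ) hS₀
  rw [Matrix.conjTranspose_eq_transpose_of_trivial] at hV
  have hsm {η : RandPath Ω d T} (hη : MemLp η 2 P) :
      secondMoment P η = crossMoment P η η := funext (secondMoment_eq_crossMoment hη)
  obtain ⟨ξ, hξX, hξs, hξ, huniq⟩ := hasUniqueStrongSolution_solves (A := A) (H := H) (hT := hT)
    (Q := V) (σ := σ) hB (memLp_of_hasLaw_multivariateGaussian hlaw)
  refine ⟨ξ, hξX, hξs, ?_, fun η hηX hη => huniq η hηX ?_⟩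
  · have hξ2 := (inX_iff_memLp hT).1 hξX
    rw [SolvesMcKeanVlasov, hsm hξ2,
      ← hV.unique (isLyapunov_of_solves hB hS₀.posSemidef hlaw hind hξ2 hξ)]
    exact hξ
  · have hη2 := (inX_iff_memLp hT).1 hηX
    rw [SolvesMcKeanVlasov, hsm hη2] at hη
    rwa [eq_of_isLyapunov_ricc_self hV
      (isLyapunov_of_solves hB hS₀.posSemidef hlaw hind hη2 hη)]

end McKeanVlasov

end FPF

end

theorem mainTheorem1 {Ω : Type*} [MeasurableSpace Ω] (P : Measure Ω) [IsProbabilityMeasure P]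
    {d m dB : ℕ} (A : Matrix (Fin d) (Fin d) ℝ) (H : Matrix (Fin m) (Fin d) ℝ)
    (σB : Matrix (Fin d) (Fin dB) ℝ) (S₀ : Matrix (Fin d) (Fin d) ℝ) (hS₀ : S₀.PosDef)
    (T : ℝ) (hT : 0 < T)
    (B : ℝ≥0 → Ω → FPF.Vec dB) (hB : FPF.IsWiener B P)
    (ξ₀ : Ω → FPF.Vec d) (hξ₀_meas : Measurable ξ₀)
    (hξ₀_law : HasLaw ξ₀ (multivariateGaussian 0 S₀) P)
    (hξ₀_indep : IndepFun ξ₀ (fun ω t => B t ω) P) :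
    -- (i) the linear equation is well posed in `𝒳` for every `Q ∈ 𝒮`
    (∀ Q : FPF.CovPath d T,
      FPF.HasUniqueStrongSolution P ξ₀ B (FPF.Solves P hT.le A H σB ξ₀ B Q.1)) ∧
    -- (i) the covariance map `F : 𝒮 → 𝒮` is well defined
    (∃ F : FPF.CovPath d T → FPF.CovPath d T,
      (∀ (Q : FPF.CovPath d T) (ξ : FPF.RandPath Ω d T), FPF.InX P ξ →
        FPF.Solves P hT.le A H σB ξ₀ B Q.1 ξ →
          ∀ t, (F Q).1 t = FPF.secondMoment P ξ t) ∧
      -- (i) the exponential bound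
      (∀ (Q : FPF.CovPath d T) (t : ℝ), t ∈ Set.Icc 0 T →
        FPF.l2 t (F Q).1 0 ≤
          Real.exp (2 * FPF.kappa A H t Q * t) * ‖S₀‖
            + FPF.expQuot (FPF.kappa A H t Q) t * ‖σB * σBᵀ‖) ∧
      -- (ii) the Lipschitz bound for `F`
      (∀ (Q U : FPF.CovPath d T) (t : ℝ), t ∈ Set.Icc 0 T →
        FPF.l2 t (F Q).1 (F U).1 ≤
          Real.exp (2 * FPF.kappa A H t Q * t) * ‖Hᵀ * H‖ * FPF.l2 t (F U).1 0
            * ∫ s in (0 : ℝ)..t, FPF.l2 s Q.1 U.1) ∧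
      -- (ii) the Lipschitz bound for `Q ↦ ξ^(Q)`
      (∀ (Q U : FPF.CovPath d T) (ξ η : FPF.RandPath Ω d T), FPF.InX P ξ → FPF.InX P η →
        FPF.Solves P hT.le A H σB ξ₀ B Q.1 ξ → FPF.Solves P hT.le A H σB ξ₀ B U.1 η →
        ∀ t : ℝ, t ∈ Set.Icc 0 T →
          FPF.L2 P t ξ η ≤ ENNReal.ofReal
            (‖Hᵀ * H‖ / 2 * Real.exp (FPF.kappa A H t Q * t)
              * Real.sqrt (d * FPF.l2 t (F U).1 0)
              * ∫ s in (0 : ℝ)..t, FPF.l2 s Q.1 U.1))) ∧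
    -- (iii) the McKean-Vlasov equation is well posed in `𝒳`
    FPF.HasUniqueStrongSolution P ξ₀ B (FPF.SolvesMcKeanVlasov P hT.le A H σB ξ₀ B) := by
  have hξ₀ := FPF.memLp_of_hasLaw_multivariateGaussian hξ₀_law
  have hR : (σB * σBᵀ).PosSemidef := by
    rw [← Matrix.conjTranspose_eq_transpose_of_trivial]
    exact Matrix.posSemidef_self_mul_conjTranspose σB
  -- `F(Q)` is taken to be the deterministic Lyapunov solution: positive definiteness is built in,
  -- and uniqueness identifies it with the second moment.
  choose V hVpos hV using fun Q : FPF.CovPath d T =>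
    FPF.exists_isLyapunov_posDef hT.le (FPF.ricc A H Q.1) hR hS₀
  have hF (Q : FPF.CovPath d T) (ξ : FPF.RandPath Ω d T) (hξ : FPF.InX P ξ)
      (hsol : FPF.Solves P hT.le A H σB ξ₀ B Q.1 ξ) : V Q = FPF.crossMoment P ξ ξ :=
    (hV Q).unique (FPF.isLyapunov_of_solves hB hS₀.posSemidef hξ₀_law hξ₀_indep
      ((FPF.inX_iff_memLp hT.le).1 hξ) hsol)
  refine ⟨fun Q => FPF.hasUniqueStrongSolution_solves hB hξ₀, ⟨fun Q => ⟨V Q, hVpos Q⟩, ?_,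
    fun Q t ht => FPF.l2_zero_le_of_isLyapunov (hV Q) ht,
    fun Q U t ht => FPF.l2_le_of_isLyapunov (hV Q) (hV U) ht, ?_⟩,
    FPF.hasUniqueStrongSolution_solvesMcKeanVlasov hB hS₀ hξ₀_law hξ₀_indep⟩
  · intro Q ξ hξ hsol t
    rw [FPF.secondMoment_eq_crossMoment ((FPF.inX_iff_memLp hT.le).1 hξ)]
    exact congrArg (fun W : C(Set.Icc (0 : ℝ) T, Matrix (Fin d) (Fin d) ℝ) => W t) (hF Q ξ hξ hsol)
  · intro Q U ξ η _ hη hξsol hηsol t ht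
    simp only [hF U η hη hηsol]
    exact FPF.L2_le_of_solves hB ((FPF.inX_iff_memLp hT.le).1 hη) hξsol hηsol ht
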